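/- Let $J,K\in\mathbb R\cup\{\infty\}$ with $J\le K$. Define the involution $$F^{(J,K)}_{udK}(x,u)=\bigl(u-\max\{x+u-J,0\}+\max\{x+u-K,0\},\; x-\max\{x+u-K,0\}+\max\{x+u-J,0\}\bigr),\qquad (x,u)\in\mathbb R^2,$$ where $\max\{s-\infty,0\}:=0$; $F^{(K,J)}_{udK}$ is the same map with the roles of the parameters exchanged. **Dynamics.** For $F=F^{(J,K)}_{udK}$ or $F=F^{(K,J)}_{udK}$ let $\mathcal X^*$ be the set of $x\in\mathbb R^{\mathbb Z}$ for which there is a unique family $(x_n^t,u_n^t)_{n,t\in\mathbb Z}$ with $F(x_n^t,u_{n-1}^t)=(x_n^{t+1},u_n^t)$ for all $n,t\in\mathbb Z$ and $x^0=x$; for such $x$ put $\mathcal T(x):=(x^1_n)_{n\in\mathbb Z}$. Let $\mathcal X^{\exists!}$ be the set of $x\in\mathbb R^{\mathbb Z}$ for which there is a unique $(u_n)_{n\in\mathbb Z}$ with $F^{(2)}(x_n,u_{n-1})=u_n$ for all $n\in\mathbb Z$; for such $x$ put $\mathcal T(x):=(F^{(1)}(x_n,u_{n-1}))_{n\in\mathbb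 Z}$. (The two definitions agree on $\mathcal X^*\cap\mathcal X^{\exists!}$.) Write $\mathcal T^{(J,K)}_{udK}$ and $\mathcal T^{(K,J)}_{udK}$ for the resulting operators. **Distributions.** $\mathrm{stExp}(\lambda,c_1,c_2)$ is the probability measure on $\mathbb R$ with density proportional to $e^{-\lambda x}$ on $[c_1,c_2]$ (on $[c_1,\infty)$ if $c_2=\infty$). For $M\in\mathbb Z$, $N\in\mathbb Z\cup\{\infty\}$, $\mathrm{sstbGeo}(1-\theta,M,N,\kappa,m)$ is the law of $X$ with $\mathbf P(X=mx)$ proportional to $\theta^x\kappa^{\iota(x)}$ for integers $M\le x\le N$, where $\iota(x)=0$ for even $x$ and $\iota(x)=1$ for odd $x$. Let $\mu,\nu$ be probability measures on $\mathbb R$ such that $\mu\times\nu$ is one of the following solutions of the detailed balance equation $F^{(J,K)}_{udK}(\mu\times\nu)=\mu\times\nu$: 1. $\mathrm{stExp}(\lambda,c,J-c)\times\mathrm{stExp}(\lambda,c,K-c)$ with $c\in\mathbb R$, $c<\min\{\frac J2,\frac K2\}$, $\lambda\in\mathbb R$, and $\lambda>0$ if $\max\{J,K\}=\infty$; 2.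 $\mathrm{sstbGeo}(1-\theta,\frac cm,\frac{J-c}m,\kappa,m)\times\mathrm{sstbGeo}(1-\theta,\frac cm,\frac{K-c}m,\kappa,m)$ with $m,\theta,\kappa>0$, $c\in m\mathbb Z$, $J,K\in m\mathbb Z\cup\{\infty\}$, $c<\min\{\frac J2,\frac K2\}$, where $\theta<1$ if $\max\{J,K\}=\infty$, and $J-2c,K-2c\in 2m\mathbb Z\cup\{\infty\}$ if $\kappa\ne1$; 3. $J=K$, and $\mu=\nu$ is any probability measure on $\mathbb R$; 4. $J<K$, and $\mu=\nu$ is any probability measure supported on $(-\infty,\frac J2]$; 5. $J<K$, $\mu=\delta_{J/2}$, and $\nu$ is any probability measure supported on $[\frac J2,K-\frac J2]$ (on $[\frac J2,\infty)$ if $K=\infty$); 6. $J<K<\infty$, $\mu$ is any probability measure supported on $[\frac J2,\infty)$, and $\nu$ is the image of $\mu$ under $x\mapsto x+K-J$. Suppose that $\mu\ne\delta_{J/2}$ (no condition if $J=\infty$) and $\nu\bigl((-\infty,\tfrac J2]\cup[K-\tfrac J2,\infty)\bigr)>0$, where $(-\infty,\frac J2]=\mathbb R$ if $J=\infty$ and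 $[K-\frac J2,\infty)=\emptyset$ if $K=\infty$. Then $\mu^{\mathbb Z}$-almost every configuration lies in $\mathcal X^*$ for $F^{(J,K)}_{udK}$, and $\mu^{\mathbb Z}$ is invariant and ergodic under $\mathcal T^{(J,K)}_{udK}$. Moreover, $\nu^{\mathbb Z}$-almost every configuration lies in $\mathcal X^*\cap\mathcal X^{\exists!}$ for $F^{(K,J)}_{udK}$, and $\nu^{\mathbb Z}$ is invariant and ergodic under $\mathcal T^{(K,J)}_{udK}$. -/

import Mathlib

open MeasureTheory

noncomputable section

/-! ### Homogeneous (type I) lattice models -/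

section Lattice

variable {X U : Type*}

/-- `xs t n` and `us t n` (time `t`, site `n`) solve the lattice equations
`F (x_n^t, u_{n-1}^t) = (x_n^{t+1}, u_n^t)` for all `n, t ∈ ℤ`, with `x^0 = x`. -/
def IsLatticeSolution (F : X × U → X × U) (x : ℤ → X) (xs : ℤ → ℤ → X) (us : ℤ → ℤ → U) : Prop :=
  (∀ n t : ℤ, F (xs t n, us t (n - 1)) = (xs (t + 1) n, us t n)) ∧ ∀ n : ℤ, xs 0 n = x n

/-- The configurations for which the initial value problem has a unique solution on the whole
space-time lattice `ℤ × ℤ`. -/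
def uniqueIVP (F : X × U → X × U) : Set (ℤ → X) :=
  {x | ∃! p : (ℤ → ℤ → X) × (ℤ → ℤ → U), IsLatticeSolution F x p.1 p.2}

/-- `u` is a carrier sequence for the configuration `x`: `F⁽²⁾(x_n, u_{n-1}) = u_n` for all `n`. -/
def IsCarrier (F : X × U → X × U) (x : ℤ → X) (u : ℤ → U) : Prop :=
  ∀ n : ℤ, (F (x n, u (n - 1))).2 = u n

/-- The configurations that admit exactly one carrier sequence. -/
def uniqueCarrier (F : X × U → X × U) : Set (ℤ → X) :=
  {x | ∃! u : ℤ → U, IsCarrier F x u}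

open Classical in
/-- The one time-step dynamics. On `uniqueIVP F` it maps `x = x^0` to `x^1`, where `x^1` is read
off the unique solution of the initial value problem; on `uniqueCarrier F` it maps `x` to
`(F⁽¹⁾(x_n, u_{n-1}))_n`, where `u` is the unique carrier sequence of `x`. (If both apply they agree:
the row `u^0` of a lattice solution is a carrier sequence.) Other configurations are outside the
domain of the dynamics; there the value is arbitrary. -/
def latticeStep (F : X × U → X × U) (x : ℤ → X) : ℤ → X :=
  if h : x ∈ uniqueIVP F then (Classical.choose (ExistsUnique.exists h)).1 1
  else if h : x ∈ uniqueCarrier F then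
    fun n => (F (x n, Classical.choose (ExistsUnique.exists h) (n - 1))).1
  else x

end Lattice

/-- A probability measure `P` is invariant and ergodic under a transformation `T` which is only
defined (and measurable) up to a `P`-null set. -/
structure IsErgodicUnder {Ω : Type*} [MeasurableSpace Ω] (T : Ω → Ω) (P : Measure Ω) : Prop where
  aemeasurable : AEMeasurable T P
  map_eq : P.map T = P
  trivial_of_invariant : ∀ s : Set Ω, MeasurableSet s → T ⁻¹' s =ᵐ[P] s → P s = 0 ∨ P sᶜ = 0

/-- The law `μ^ℤ` of an i.i.d. sequence indexed by `ℤ` with marginal `μ`. -/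
def iidLaw (μ : Measure ℝ) : Measure (ℤ → ℝ) :=
  Measure.infinitePi fun _ : ℤ => μ

/-! ### The (modified) ultra-discrete KdV map -/

/-- `max {s - J, 0}`, which is `0` for `J = ∞`. -/
def excess : WithTop ℝ → ℝ → ℝ
  | ⊤, _ => 0
  | (j : ℝ), s => max (s - j) 0

/-- The map `F_udK^{(J,K)}`, with `J, K ∈ ℝ ∪ {∞}`. -/
def udK (J K : WithTop ℝ) (p : ℝ × ℝ) : ℝ × ℝ :=
  (p.2 - excess J (p.1 + p.2) + excess K (p.1 + p.2),
    p.1 - excess K (p.1 + p.2) + excess J (p.1 + p.2))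

/-! ### The distributions -/

/-- The measure `Z⁻¹ m`, where `Z` is the total mass of `m`. -/
def normalizedMeasure (m : Measure ℝ) : Measure ℝ :=
  (m Set.univ)⁻¹ • m

/-- The shifted truncated exponential distribution, with density `Z⁻¹ e^{-lam x}` on `[c₁, c₂]`
(on `[c₁, ∞)` if `c₂ = ∞`). -/
def stExp (lam c₁ : ℝ) (c₂ : WithTop ℝ) : Measure ℝ :=
  normalizedMeasure <|
    (volume.restrict {x : ℝ | c₁ ≤ x ∧ (x : WithTop ℝ) ≤ c₂}).withDensity
      fun x => ENNReal.ofReal (Real.exp (-lam * x))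

open Classical in
/-- The shifted scaled truncated bipartite geometric distribution `sstbGeo(1 - θ, M, N, κ, m)`:
`P(X = m x) = Z⁻¹ θ^x κ^{ι(x)}` for integers `M ≤ x ≤ N`, where `ι(x)` is `0` for even `x` and `1`
for odd `x`. -/
def sstbGeo (θ : ℝ) (M : ℤ) (N : WithTop ℤ) (κ m : ℝ) : Measure ℝ :=
  normalizedMeasure <| Measure.sum fun x : ℤ =>
    (if M ≤ x ∧ (x : WithTop ℤ) ≤ N then
      ENNReal.ofReal (θ ^ x * if Even x then 1 else κ) else 0) • Measure.dirac (m * (x : ℝ))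

/-! The laws above are probability measures for all admissible parameters. -/

theorem normalizedMeasure_isProb {m : Measure ℝ} (h0 : m Set.univ ≠ 0) (h1 : m Set.univ ≠ ⊤) :
    IsProbabilityMeasure (normalizedMeasure m) :=
  IsProbabilityMeasure.mk (by simp [normalizedMeasure, ENNReal.inv_mul_cancel h0 h1])

theorem stExp_isProb {lam c₁ : ℝ} {c₂ : WithTop ℝ} (h : (c₁ : WithTop ℝ) < c₂)
    (htop : c₂ = ⊤ → 0 < lam) : IsProbabilityMeasure (stExp lam c₁ c₂) := by
  apply normalizedMeasure_isProb
  · rw [withDensity_apply _ MeasurableSet.univ, Measure.restrict_univ]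
    have hm : Measurable fun x : ℝ => ENNReal.ofReal (Real.exp (-lam * x)) := by fun_prop
    rw [Ne, lintegral_eq_zero_iff hm]
    intro hc
    have hv : volume {x : ℝ | c₁ ≤ x ∧ (x : WithTop ℝ) ≤ c₂} = 0 := by
      rw [← Measure.restrict_eq_zero, ← Measure.measure_univ_eq_zero]
      refine measure_mono_null ?_ hc
      intro x _
      simp [Real.exp_pos]
    obtain ⟨b, hb1, hb2⟩ : ∃ b : ℝ, c₁ < b ∧ (b : WithTop ℝ) ≤ c₂ := by
      induction c₂ using WithTop.recTopCoe with
      | top => exact ⟨c₁ + 1, by linarith, le_top⟩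
      | coe b => exact ⟨b, by exact_mod_cast h, le_rfl⟩
    have hsub : Set.Icc c₁ b ⊆ {x : ℝ | c₁ ≤ x ∧ (x : WithTop ℝ) ≤ c₂} :=
      fun x hx => ⟨hx.1, le_trans (by exact_mod_cast hx.2) hb2⟩
    have := measure_mono_null hsub hv
    rw [Real.volume_Icc] at this
    simp at this
    linarith
  · rw [withDensity_apply _ MeasurableSet.univ, Measure.restrict_univ]
    induction c₂ using WithTop.recTopCoe with
    | top =>
      have hs : {x : ℝ | c₁ ≤ x ∧ (x : WithTop ℝ) ≤ ⊤} = Set.Ici c₁ := by ext; simp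
      rw [hs, ← restrict_Ioi_eq_restrict_Ici]
      have := (integrableOn_exp_mul_Ioi (a := -lam) (by linarith [htop rfl]) c₁)
      exact (Integrable.lintegral_lt_top this).ne
    | coe b =>
      have hs : {x : ℝ | c₁ ≤ x ∧ (x : WithTop ℝ) ≤ (b : WithTop ℝ)} = Set.Icc c₁ b := by
        ext; simp
      rw [hs]
      have : IntegrableOn (fun x : ℝ => Real.exp (-lam * x)) (Set.Icc c₁ b) :=
        (by fun_prop : Continuous fun x : ℝ => Real.exp (-lam * x)).integrableOn_Icc
      exact (Integrable.lintegral_lt_top this).ne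

theorem sstbGeo_isProb {θ κ m : ℝ} {M : ℤ} {N : WithTop ℤ} (hθ : 0 < θ) (hκ : 0 < κ)
    (h : (M : WithTop ℤ) ≤ N) (htop : N = ⊤ → θ < 1) :
    IsProbabilityMeasure (sstbGeo θ M N κ m) := by
  classical
  apply normalizedMeasure_isProb
  · rw [Measure.sum_apply _ MeasurableSet.univ]
    intro h0
    rw [ENNReal.tsum_eq_zero] at h0
    have := h0 M
    by_cases hM : Even M <;> simp [h, hM] at this
    · exact absurd this (not_le.2 (by positivity))
    · exact absurd this (not_le.2 (by positivity))
  · rw [Measure.sum_apply _ MeasurableSet.univ]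
    have key : Summable fun x : ℤ => if M ≤ x ∧ (x : WithTop ℤ) ≤ N then θ ^ x * (1 + κ) else 0 := by
      induction N using WithTop.recTopCoe with
      | coe N =>
        apply summable_of_ne_finset_zero (s := Finset.Icc M N)
        intro b hb
        rw [if_neg]
        simpa using hb
      | top =>
        have hinj : Function.Injective (fun k : ℕ => M + (k : ℤ)) := by
          intro a b hab; simpa using hab
        rw [← hinj.summable_iff]
        · have : (fun k : ℕ => θ ^ M * (1 + κ) * θ ^ k) = (fun x : ℤ => if M ≤ x ∧ (x : WithTop ℤ) ≤ ⊤ then θ ^ x * (1 + κ) else 0) ∘ (fun k : ℕ => M + (k : ℤ)) := by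
            ext k
            simp [zpow_add₀ hθ.ne']
            ring
          rw [← this]
          exact (summable_geometric_of_lt_one hθ.le (htop rfl)).mul_left _
        · intro x hx
          rw [if_neg]
          rintro ⟨h1, -⟩
          exact hx ⟨(x - M).toNat, by simp; omega⟩
    refine ne_top_of_le_ne_top key.tsum_ofReal_ne_top (ENNReal.tsum_le_tsum fun x => ?_)
    by_cases hx : M ≤ x ∧ (x : WithTop ℤ) ≤ N
    · simp only [hx, and_self, if_true, Measure.smul_apply, measure_univ, smul_eq_mul, mul_one]
      apply ENNReal.ofReal_le_ofReal
      have : 0 < θ ^ x := by positivity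
      split_ifs <;> nlinarith
    · simp [hx]

/-- The listed families of pairs `(μ, ν)` of probability measures that solve the detailed balance
equation `F_udK^{(J,K)}(μ × ν) = μ × ν` (the equation itself is not imposed, it follows). -/
inductive IsUdKSolution (J K : WithTop ℝ) : Measure ℝ → Measure ℝ → Prop
  /-- Truncated exponential marginals, for `c < min {J/2, K/2}`. -/
  | exponential (lam c : ℝ) (hlam : J = ⊤ ∨ K = ⊤ → 0 < lam)
      (hJ : ((2 * c : ℝ) : WithTop ℝ) < J) (hK : ((2 * c : ℝ) : WithTop ℝ) < K) :
      IsUdKSolution J K (stExp lam c (J.map fun j => j - c)) (stExp lam c (K.map fun k => k - c))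
  /-- Truncated bipartite geometric marginals: here `c = m M`, `J = m J'`, `K = m K'` with integers
  `M, J', K'` (or `J' = ∞`, `K' = ∞`) and `c < min {J/2, K/2}`. If `κ ≠ 1`, then `J - 2c` and
  `K - 2c` have to lie in `2mℤ ∪ {∞}`. -/
  | geometric (m θ κ : ℝ) (M : ℤ) (J' K' : WithTop ℤ) (hm : 0 < m) (hθ : 0 < θ) (hκ : 0 < κ)
      (hJm : J = J'.map fun a : ℤ => m * (a : ℝ)) (hKm : K = K'.map fun a : ℤ => m * (a : ℝ))
      (hJ : ((2 * M : ℤ) : WithTop ℤ) < J') (hK : ((2 * M : ℤ) : WithTop ℤ) < K')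
      (hθtop : J = ⊤ ∨ K = ⊤ → θ < 1)
      (hJeven : κ ≠ 1 → ∀ a : ℤ, J' = (a : WithTop ℤ) → Even (a - 2 * M))
      (hKeven : κ ≠ 1 → ∀ a : ℤ, K' = (a : WithTop ℤ) → Even (a - 2 * M)) :
      IsUdKSolution J K (sstbGeo θ M (J'.map fun a : ℤ => a - M) κ m)
        (sstbGeo θ M (K'.map fun a : ℤ => a - M) κ m)
  /-- `J = K`: any measure, twice. -/
  | diagonal (m : Measure ℝ) (hm : IsProbabilityMeasure m) (hJK : J = K) : IsUdKSolution J K m m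
  /-- `J < K`: any measure supported on `(-∞, J/2]`, twice. -/
  | low (j : ℝ) (hj : J = (j : WithTop ℝ)) (hJK : J < K)
      (m : Measure ℝ) (hm : IsProbabilityMeasure m)
      (hsupp : ∀ᵐ x ∂m, x ≤ j / 2) : IsUdKSolution J K m m
  /-- `J < K`: `δ_{J/2}` and any measure supported on `[J/2, K - J/2]`. -/
  | point (j : ℝ) (hj : J = (j : WithTop ℝ)) (hJK : J < K)
      (m : Measure ℝ) (hm : IsProbabilityMeasure m)
      (hsupp : ∀ᵐ x ∂m, j / 2 ≤ x ∧ ((x + j / 2 : ℝ) : WithTop ℝ) ≤ K) :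
      IsUdKSolution J K (Measure.dirac (j / 2)) m
  /-- `J < K < ∞`: any measure supported on `[J/2, ∞)`, and its translate by `L = K - J`. -/
  | high (j k : ℝ) (hj : J = (j : WithTop ℝ)) (hk : K = (k : WithTop ℝ)) (hjk : j < k)
      (m : Measure ℝ) (hm : IsProbabilityMeasure m)
      (hsupp : ∀ᵐ x ∂m, j / 2 ≤ x) :
      IsUdKSolution J K m (m.map fun x => x + (k - j))

/-- Both members of every listed pair are probability measures, so that `iidLaw` is the genuine
product measure for them. -/
theorem IsUdKSolution.isProb {J K : WithTop ℝ} {μ ν : Measure ℝ} (h : IsUdKSolution J K μ ν) :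
    IsProbabilityMeasure μ ∧ IsProbabilityMeasure ν := by
  have aux : ∀ (A : WithTop ℝ) (lam c : ℝ), ((2 * c : ℝ) : WithTop ℝ) < A → (A = ⊤ → 0 < lam) →
      IsProbabilityMeasure (stExp lam c (A.map fun a => a - c)) := by
    intro A lam c hA hl
    refine stExp_isProb ?_ fun h => hl ?_
    · induction A using WithTop.recTopCoe with
      | top => simp
      | coe a =>
        have : 2 * c < a := by exact_mod_cast hA
        simp only [WithTop.map_coe]
        exact_mod_cast (by linarith : c < a - c)
    · simpa using h
  have aux2 : ∀ (A : WithTop ℤ) (θ κ m : ℝ) (M : ℤ), 0 < θ → 0 < κ →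
      ((2 * M : ℤ) : WithTop ℤ) < A → (A = ⊤ → θ < 1) →
      IsProbabilityMeasure (sstbGeo θ M (A.map fun a : ℤ => a - M) κ m) := by
    intro A θ κ m M hθ hκ hA hl
    refine sstbGeo_isProb hθ hκ ?_ fun h => hl ?_
    · induction A using WithTop.recTopCoe with
      | top => simp
      | coe a =>
        have : 2 * M < a := by exact_mod_cast hA
        simp only [WithTop.map_coe]
        exact_mod_cast (by linarith : M ≤ a - M)
    · simpa using h
  cases h with
  | exponential lam c hlam hJ hK =>
    exact ⟨aux _ _ _ hJ fun h => hlam (.inl h), aux _ _ _ hK fun h => hlam (.inr h)⟩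
  | geometric m θ κ M J' K' hm hθ hκ hJm hKm hJ hK ht =>
    exact ⟨aux2 _ _ _ _ _ hθ hκ hJ fun h => ht (.inl (by simp [hJm, h])),
      aux2 _ _ _ _ _ hθ hκ hK fun h => ht (.inr (by simp [hKm, h]))⟩
  | diagonal _ hm => exact ⟨hm, hm⟩
  | low j hj hJK _ hm => exact ⟨hm, hm⟩
  | point j hj hJK _ hm => exact ⟨inferInstance, hm⟩
  | high j k hj hk hjk _ hm =>
    exact ⟨hm, Measure.isProbabilityMeasure_map (by fun_prop)⟩

/-- The set `(-∞, J/2] ∪ [K - J/2, ∞)`; the first interval is `ℝ` if `J = ∞`, and the second one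
is empty if `J = ∞` or `K = ∞`. -/
def outerSet (J K : WithTop ℝ) : Set ℝ :=
  {y | ((2 * y : ℝ) : WithTop ℝ) ≤ J} ∪
    {y | ∃ j k : ℝ, J = (j : WithTop ℝ) ∧ K = (k : WithTop ℝ) ∧ k - j / 2 ≤ y}

end

open MeasureTheory Filter Topology Set

/-! The map preserves `μ × ν`, so sweeping it over finitely many sites, starting with an independent
carrier of law `ν`, preserves `μ^ℤ × ν`. If the carrier almost surely forgets its value in the far
past, the starting site can be sent to `-∞` (`tendsto_sweep`). In the limit, the carrier at a site
has law `ν` and is independent of the configuration updated up to that site, and that configuration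
is again i.i.d. (`HasForgetfulCarrier.map_pastStepUpTo_pastCarrier`). This gives invariance of
`μ^ℤ`. Iterated in time, it shows that the carriers passing site `0` form an i.i.d. sequence of law
`ν`.

Ergodicity comes from exchanging space and time. Transposing a lattice solution yields a solution
for the swapped map, which is `udK K J`. If its carrier forgets as well, the configuration can be
recovered from the carriers at site `0`. A time step then becomes the unit shift of an i.i.d.
sequence, which is ergodic because it is mixing. Uniqueness backward in time follows from uniqueness
forward, since `F` is an involution and reversing both axes preserves the lattice equations.

It remains to prove forgetfulness. For finite `K`, and for the map with exchanged parameters,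
finitely many suitable successive values fix the carrier whatever it was (`IsResetBlock`), and such
blocks occur almost surely in the past. For `J < K = ∞` the carrier of `udK J K` obeys a Lindley
recursion with negative drift. It forgets every fixed start, yet further carriers coming from
infinity exist. Those turn the configuration into one with no carrier at all, so they belong to no
lattice solution (`carrier_eq_of_isCarrier_of_isCarrier`). -/

instance iidLaw_isProbabilityMeasure (μ : Measure ℝ) [IsProbabilityMeasure μ] :
    IsProbabilityMeasure (iidLaw μ) := by
  unfold iidLaw; infer_instance

/-- Translation of a configuration by `k` sites. -/
def shiftBy (k : ℤ) (x : ℤ → ℝ) : ℤ → ℝ := fun n => x (n + k)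

/-- Spatial reflection of a configuration. -/
def reflect (x : ℤ → ℝ) : ℤ → ℝ := fun n => x (-n)

@[simp] theorem shiftBy_apply (k : ℤ) (x : ℤ → ℝ) (n : ℤ) : shiftBy k x n = x (n + k) := rfl

@[simp] theorem reflect_apply (x : ℤ → ℝ) (n : ℤ) : reflect x n = x (-n) := rfl

@[simp] theorem reflect_reflect (x : ℤ → ℝ) : reflect (reflect x) = x := by
  funext n; simp

@[simp] theorem shiftBy_zero (x : ℤ → ℝ) : shiftBy 0 x = x := by
  funext n; simp

theorem shiftBy_shiftBy (k l : ℤ) (x : ℤ → ℝ) : shiftBy k (shiftBy l x) = shiftBy (k + l) x := by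
  funext n; simp [add_assoc]

@[fun_prop] theorem measurable_shiftBy (k : ℤ) : Measurable (shiftBy k) :=
  measurable_pi_lambda _ fun _ => measurable_pi_apply _

@[fun_prop] theorem measurable_reflect : Measurable reflect :=
  measurable_pi_lambda _ fun _ => measurable_pi_apply _

/-! ### I.i.d. sequences: mixing, ergodicity of the shift, resampling, limits of laws -/

section IID

variable (μ : Measure ℝ) [IsProbabilityMeasure μ]

theorem measurePreserving_shiftBy (k : ℤ) :
    MeasurePreserving (shiftBy k) (iidLaw μ) (iidLaw μ) :=
  ⟨measurable_shiftBy k, Measure.map_infinitePi_infinitePi_of_inj (add_left_injective k)⟩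

theorem measurePreserving_reflect : MeasurePreserving reflect (iidLaw μ) (iidLaw μ) :=
  ⟨measurable_reflect, Measure.map_infinitePi_infinitePi_of_inj neg_injective⟩

variable {μ}

/-- A π-λ argument in `A` with the sequence `B` fixed. The common mass `b` handles complements; for
disjoint unions the series is dominated by the masses of the pieces. -/
theorem tendsto_measureReal_inter_of_cylinders {B : ℕ → Set (ℤ → ℝ)} (hB : ∀ n, MeasurableSet (B n))
    {b : ℝ} (hb : ∀ n, (iidLaw μ).real (B n) = b)
    (hcyl : ∀ (s : Finset ℤ) (t : ℤ → Set ℝ), (∀ i, MeasurableSet (t i)) →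
      Tendsto (fun n => (iidLaw μ).real ((s : Set ℤ).pi t ∩ B n)) atTop
        (𝓝 ((iidLaw μ).real ((s : Set ℤ).pi t) * b)))
    {A : Set (ℤ → ℝ)} (hA : MeasurableSet A) :
    Tendsto (fun n => (iidLaw μ).real (A ∩ B n)) atTop (𝓝 ((iidLaw μ).real A * b)) := by
  induction A, hA using MeasurableSpace.induction_on_inter
    (generateFrom_squareCylinders (α := fun _ : ℤ => ℝ)).symm
    (isPiSystem_squareCylinders (fun _ => MeasurableSpace.isPiSystem_measurableSet) (by simp)) with
  | empty => simp
  | basic A hA =>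
    obtain ⟨s, t, ht, rfl⟩ := hA
    exact hcyl s t fun i => ht i (mem_univ i)
  | compl A hA ih =>
    have h1 : ∀ n, (iidLaw μ).real (Aᶜ ∩ B n) = b - (iidLaw μ).real (A ∩ B n) := by
      intro n
      have := measureReal_inter_add_sdiff (μ := iidLaw μ) (s := B n) hA
      rw [hb n] at this
      rw [inter_comm A, inter_comm Aᶜ, ← sdiff_eq]
      linarith
    simp_rw [h1, probReal_compl_eq_one_sub hA, sub_mul, one_mul]
    exact ih.const_sub b
  | iUnion f hd hf ih =>
    have h1 : ∀ n, (iidLaw μ).real ((⋃ i, f i) ∩ B n) = ∑' i, (iidLaw μ).real (f i ∩ B n) := by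
      intro n
      rw [iUnion_inter, measureReal_def, measure_iUnion
        (fun i j hij => (hd hij).mono inter_subset_left inter_subset_left)
        (fun i => (hf i).inter (hB n)), ENNReal.tsum_toReal_eq fun _ => measure_ne_top _ _]
      rfl
    have h2 : (iidLaw μ).real (⋃ i, f i) = ∑' i, (iidLaw μ).real (f i) := by
      rw [measureReal_def, measure_iUnion hd hf, ENNReal.tsum_toReal_eq fun _ => measure_ne_top _ _]
      rfl
    have hs : Summable fun i => (iidLaw μ).real (f i) :=
      ENNReal.summable_toReal (by rw [← measure_iUnion hd hf]; exact measure_ne_top _ _)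
    simp_rw [h1, h2, ← tsum_mul_right]
    refine tendsto_tsum_of_dominated_convergence hs ih (.of_forall fun n i => ?_)
    rw [Real.norm_of_nonneg measureReal_nonneg]
    exact measureReal_mono inter_subset_left

theorem iidLaw_pi (s : Finset ℤ) {t : ℤ → Set ℝ} (ht : ∀ i, MeasurableSet (t i)) :
    iidLaw μ ((s : Set ℤ).pi t) = ∏ i ∈ s, μ (t i) :=
  Measure.infinitePi_pi (fun _ : ℤ => μ) fun i _ => ht i

theorem iidLaw_real_pi (s : Finset ℤ) {t : ℤ → Set ℝ} (ht : ∀ i, MeasurableSet (t i)) :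
    (iidLaw μ).real ((s : Set ℤ).pi t) = ∏ i ∈ s, μ.real (t i) := by
  rw [measureReal_def, iidLaw_pi s ht, ENNReal.toReal_prod]
  rfl

/-- Once `n` is large, the two finite sets of coordinates are disjoint and the intersection is a
single cylinder, so the masses factor exactly. -/
theorem iidLaw_real_pi_inter_shiftBy (s s' : Finset ℤ) {t t' : ℤ → Set ℝ}
    (ht : ∀ i, MeasurableSet (t i)) (ht' : ∀ i, MeasurableSet (t' i)) :
    ∀ᶠ n : ℕ in atTop,
      (iidLaw μ).real ((s : Set ℤ).pi t ∩ shiftBy (n : ℤ) ⁻¹' ((s' : Set ℤ).pi t')) =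
        (iidLaw μ).real ((s : Set ℤ).pi t) * (iidLaw μ).real ((s' : Set ℤ).pi t') := by
  classical
  obtain ⟨a, ha⟩ := s.bddAbove
  obtain ⟨b, hb⟩ := s'.bddBelow
  filter_upwards [eventually_gt_atTop (a - b).toNat] with n hn
  have hlt : ∀ i ∈ s', i + (n : ℤ) ∉ s := by
    intro i hi hs
    have h1 := ha hs
    have h2 := hb hi
    omega
  set s'' := s'.map (addRightEmbedding (n : ℤ)) with hs''
  have hdisj : Disjoint s s'' := by
    rw [Finset.disjoint_right]
    intro i hi
    obtain ⟨k, hk, rfl⟩ := Finset.mem_map.1 hi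
    exact hlt k hk
  have hset : (s : Set ℤ).pi t ∩ shiftBy (n : ℤ) ⁻¹' ((s' : Set ℤ).pi t') =
      ((s ∪ s'' : Finset ℤ) : Set ℤ).pi fun i => if i ∈ s then t i else t' (i - n) := by
    ext x
    simp only [mem_inter_iff, Set.mem_pi, mem_preimage, shiftBy_apply, Finset.mem_coe,
      Finset.mem_union]
    constructor
    · rintro ⟨h1, h2⟩ i (hi | hi)
      · rw [if_pos hi]; exact h1 i hi
      · rw [if_neg (Finset.disjoint_right.1 hdisj hi)]
        obtain ⟨k, hk, rfl⟩ := Finset.mem_map.1 hi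
        simpa using h2 k hk
    · intro h
      refine ⟨fun i hi => by simpa [hi] using h i (.inl hi), fun i hi => ?_⟩
      have := h (i + n) (.inr (Finset.mem_map.2 ⟨i, hi, rfl⟩))
      rw [if_neg (hlt i hi)] at this
      simpa using this
  rw [hset, iidLaw_real_pi _ fun i => by split_ifs <;> simp [ht, ht'], iidLaw_real_pi _ ht,
    iidLaw_real_pi _ ht', Finset.prod_union hdisj, hs'', Finset.prod_map]
  congr 1
  · exact Finset.prod_congr rfl fun i hi => by rw [if_pos hi]
  · refine Finset.prod_congr rfl fun i hi => ?_
    rw [addRightEmbedding_apply, if_neg (hlt i hi), add_sub_cancel_right]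

/-- The translations of an i.i.d. sequence are mixing. -/
theorem tendsto_iidLaw_real_inter_shiftBy {A B : Set (ℤ → ℝ)} (hA : MeasurableSet A)
    (hB : MeasurableSet B) :
    Tendsto (fun n : ℕ => (iidLaw μ).real (A ∩ shiftBy (n : ℤ) ⁻¹' B)) atTop
      (𝓝 ((iidLaw μ).real A * (iidLaw μ).real B)) := by
  have hpres (k : ℤ) {C : Set (ℤ → ℝ)} (hC : MeasurableSet C) :
      (iidLaw μ).real (shiftBy k ⁻¹' C) = (iidLaw μ).real C :=
    (measurePreserving_shiftBy μ k).measureReal_preimage hC.nullMeasurableSet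
  have hswap (n : ℕ) {A B : Set (ℤ → ℝ)} (hA : MeasurableSet A) (hB : MeasurableSet B) :
      (iidLaw μ).real (A ∩ shiftBy (n : ℤ) ⁻¹' B) =
        (iidLaw μ).real (B ∩ shiftBy (-n : ℤ) ⁻¹' A) := by
    rw [← hpres (n : ℤ) (hB.inter (measurable_shiftBy _ hA)), inter_comm A]
    congr 1
    ext x
    simp [shiftBy_shiftBy]
  have hcyl (s : Finset ℤ) (t : ℤ → Set ℝ) (ht : ∀ i, MeasurableSet (t i)) :
      MeasurableSet ((s : Set ℤ).pi t) :=
    MeasurableSet.pi s.countable_toSet fun i _ => ht i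
  have key : ∀ (s : Finset ℤ) (t : ℤ → Set ℝ), (∀ i, MeasurableSet (t i)) →
      Tendsto (fun n : ℕ => (iidLaw μ).real (A ∩ shiftBy (n : ℤ) ⁻¹' ((s : Set ℤ).pi t))) atTop
      (𝓝 ((iidLaw μ).real A * (iidLaw μ).real ((s : Set ℤ).pi t))) := by
    intro s t ht
    refine tendsto_measureReal_inter_of_cylinders (fun n => measurable_shiftBy _ (hcyl s t ht))
      (fun n => hpres _ (hcyl s t ht)) (fun s' t' ht' => ?_) hA
    exact tendsto_const_nhds.congr' (EventuallyEq.symm (iidLaw_real_pi_inter_shiftBy s' s ht' ht))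
  -- The induction lemma only varies the first set. `key` treats `B` a cylinder; moving the
  -- translation onto `A` lets the lemma be applied a second time, now in `B`.
  simp_rw [hswap _ hA hB]
  rw [mul_comm]
  refine tendsto_measureReal_inter_of_cylinders (fun n => measurable_shiftBy _ hA)
      (fun n => hpres _ hA) (fun s t ht => ?_) hB
  simp_rw [← hswap _ hA (hcyl s t ht)]
  rw [mul_comm]
  exact key s t ht

/-- Mixing of an invariant set with itself gives `P(s) = P(s)²`. -/
theorem ergodic_shiftBy_one : Ergodic (shiftBy 1) (iidLaw μ) := by
  refine ⟨measurePreserving_shiftBy μ 1, ⟨fun {s} hs hinv => ?_⟩⟩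
  have hn : ∀ n : ℕ, shiftBy (n : ℤ) ⁻¹' s = s := by
    intro n
    induction n with
    | zero => ext x; simp
    | succ n ih =>
      ext x
      rw [mem_preimage, Nat.cast_succ, ← shiftBy_shiftBy, ← mem_preimage, ih, ← mem_preimage, hinv]
  have h := tendsto_iidLaw_real_inter_shiftBy (μ := μ) hs hs
  simp_rw [hn, inter_self] at h
  have h1 := tendsto_nhds_unique h tendsto_const_nhds
  rw [eventuallyConst_set']
  have h2 : (iidLaw μ).real s = 0 ∨ (iidLaw μ).real s = 1 := by
    rcases eq_or_ne ((iidLaw μ).real s) 0 with h0 | h0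
    · exact .inl h0
    · exact .inr (mul_left_cancel₀ h0 (by rw [h1, mul_one]))
  rcases h2 with h2 | h2
  · left
    exact ae_eq_empty.2 ((measureReal_eq_zero_iff).1 h2)
  · right
    rw [ae_eq_univ, ← measureReal_eq_zero_iff, probReal_compl_eq_one_sub hs, h2, sub_self]

/-- Arbitrary finite patterns of positive probability occur in the past. -/
theorem ae_exists_block {B : Set ℝ} (hB : MeasurableSet B) (hpos : 0 < μ B) (L : ℕ) :
    ∀ᵐ x ∂(iidLaw μ), ∃ n : ℕ, ∀ i < L, x (-n - i) ∈ B := by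
  set A : ℕ → Set (ℤ → ℝ) := fun n => {x | ∀ i < L, x (-n - i) ∈ B} with hA
  have hAm : ∀ n, MeasurableSet (A n) := by
    intro n
    have : A n = ⋂ i ∈ Finset.range L, (fun x : ℤ → ℝ => x (-n - i)) ⁻¹' B := by
      ext x; simp [hA]
    rw [this]
    exact Finset.measurableSet_biInter _ fun i _ => measurable_pi_apply _ hB
  have hmeas : MeasurableSet (⋃ n, A n) := MeasurableSet.iUnion hAm
  -- The event is carried into itself by the shift, so by ergodicity its probability is `0` or `1`;
  -- the block at `n = 0` already has positive probability.
  have hsub : (⋃ n, A n) ⊆ shiftBy 1 ⁻¹' (⋃ n, A n) := by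
    intro x hx
    obtain ⟨n, hn⟩ := mem_iUnion.1 hx
    refine mem_iUnion.2 ⟨n + 1, fun i hi => ?_⟩
    have := hn i hi
    rw [shiftBy_apply]
    convert this using 2
    push_cast; ring
  have hne : iidLaw μ (⋃ n, A n) ≠ 0 := by
    have h0 : A 0 = (((Finset.range L).image fun i : ℕ => -(i : ℤ) : Finset ℤ) : Set ℤ).pi
        fun _ => B := by
      ext x; simp [hA]
    refine (lt_of_lt_of_le ?_ (measure_mono (subset_iUnion A 0))).ne'
    rw [h0, iidLaw_pi _ fun _ => hB]
    exact pos_iff_ne_zero.2 (Finset.prod_ne_zero_iff.2 fun _ _ => hpos.ne')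
  rcases (ergodic_shiftBy_one (μ := μ)).ae_empty_or_univ_of_ae_le_preimage
    hmeas.nullMeasurableSet (LE.le.eventuallyLE hsub) with h | h
  · exact absurd (ae_eq_empty.1 h) hne
  · filter_upwards [ae_eq_univ_iff_measure_eq hmeas.nullMeasurableSet |>.1 h |> fun h' =>
      (mem_ae_iff_prob_eq_one hmeas).2 (h'.trans measure_univ)] with x hx
    exact mem_iUnion.1 hx

/-- Resampling one coordinate does not change the law. This allows the value at `k` to be treated as
a separate independent factor, on which the two-variable map can act. -/
theorem measurePreserving_update (k : ℤ) :
    MeasurePreserving (fun p : (ℤ → ℝ) × ℝ => Function.update p.1 k p.2) ((iidLaw μ).prod μ)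
      (iidLaw μ) := by
  have hm : Measurable fun p : (ℤ → ℝ) × ℝ => Function.update p.1 k p.2 := by
    refine measurable_pi_lambda _ fun i => ?_
    rcases eq_or_ne i k with rfl | h
    · simpa using measurable_snd
    · simp only [Function.update_of_ne h]
      fun_prop
  refine ⟨hm, Measure.eq_infinitePi (fun _ : ℤ => μ) fun s t ht => ?_⟩
  rw [Measure.map_apply hm (MeasurableSet.pi s.countable_toSet fun i _ => ht i)]
  by_cases hk : k ∈ s
  · have : (fun p : (ℤ → ℝ) × ℝ => Function.update p.1 k p.2) ⁻¹' ((s : Set ℤ).pi t) =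
        (((s.erase k : Finset ℤ) : Set ℤ).pi t) ×ˢ (t k) := by
      ext ⟨x, b⟩
      simp only [mem_preimage, Set.mem_pi, Finset.mem_coe, mem_prod, Finset.mem_erase]
      constructor
      · intro h
        refine ⟨fun i hi => by simpa [hi.1] using h i hi.2, by simpa using h k hk⟩
      · rintro ⟨h1, h2⟩ i hi
        rcases eq_or_ne i k with rfl | hik
        · simpa using h2
        · simpa [hik] using h1 i ⟨hik, hi⟩
    rw [this, Measure.prod_prod, iidLaw_pi _ ht,
      Finset.prod_erase_mul _ _ hk]
  · have : (fun p : (ℤ → ℝ) × ℝ => Function.update p.1 k p.2) ⁻¹' ((s : Set ℤ).pi t) =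
        ((s : Set ℤ).pi t) ×ˢ univ := by
      ext ⟨x, b⟩
      simp only [mem_preimage, Set.mem_pi, Finset.mem_coe, mem_prod, mem_univ, and_true]
      refine forall₂_congr fun i hi => ?_
      rw [Function.update_of_ne (ne_of_mem_of_not_mem hi hk)]
    rw [this, Measure.prod_prod, iidLaw_pi _ ht, measure_univ,
      mul_one]

/-- Almost surely convergent random variables with a common law have that law in the limit. -/
theorem map_eq_of_tendsto_of_map_eq {Ω E : Type*} [MeasurableSpace Ω] [TopologicalSpace E]
    [MeasurableSpace E] [BorelSpace E] [HasOuterApproxClosed E] {P : Measure Ω}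
    [IsProbabilityMeasure P]
    {Q : Measure E} [IsProbabilityMeasure Q] {X : ℕ → Ω → E} {Y : Ω → E}
    (hX : ∀ n, Measurable (X n)) (hY : Measurable Y) (hlaw : ∀ n, P.map (X n) = Q)
    (hlim : ∀ᵐ ω ∂P, Tendsto (fun n => X n ω) atTop (𝓝 (Y ω))) : P.map Y = Q := by
  have : IsProbabilityMeasure (P.map Y) := Measure.isProbabilityMeasure_map hY.aemeasurable
  refine ext_of_forall_integral_eq_of_IsFiniteMeasure fun f => ?_
  have h1 : Tendsto (fun n => ∫ ω, f (X n ω) ∂P) atTop (𝓝 (∫ ω, f (Y ω) ∂P)) := by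
    refine tendsto_integral_of_dominated_convergence (fun _ => ‖f‖)
      (fun n => (f.continuous.measurable.comp (hX n)).aestronglyMeasurable)
      (integrable_const _) (fun n => .of_forall fun ω => f.norm_coe_le_norm _) ?_
    filter_upwards [hlim] with ω hω
    exact (f.continuous.tendsto _).comp hω
  have h2 : ∀ n, ∫ ω, f (X n ω) ∂P = ∫ e, f e ∂Q := by
    intro n
    rw [← hlaw n, integral_map (hX n).aemeasurable
      f.continuous.measurable.aestronglyMeasurable]
  simp_rw [h2] at h1
  rw [integral_map hY.aemeasurable f.continuous.measurable.aestronglyMeasurable]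
  exact tendsto_nhds_unique h1 tendsto_const_nhds

end IID

/-! ### Carriers started from the far past -/

/-- The carrier at site `0` when the carrier has value `a` at site `-N`. -/
def carrierFrom (F : ℝ × ℝ → ℝ × ℝ) : ℕ → ℝ → (ℤ → ℝ) → ℝ
  | 0, a, _ => a
  | N + 1, a, x => (F (x 0, carrierFrom F N a (shiftBy (-1) x))).2

/-- The value `c` of the carrier at site `0` is eventually reached from every initial value in the
far past. -/
def IsSync (F : ℝ × ℝ → ℝ × ℝ) (x : ℤ → ℝ) (c : ℝ) : Prop :=
  ∀ a, ∀ᶠ N in atTop, carrierFrom F N a x = c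

/-- The carrier at site `0` started from the far past. -/
noncomputable def pastCarrier (F : ℝ × ℝ → ℝ × ℝ) (x : ℤ → ℝ) : ℝ :=
  limUnder atTop fun N => carrierFrom F N 0 x

/-- The dynamics with the carrier started from the far past. -/
noncomputable def pastStep (F : ℝ × ℝ → ℝ × ℝ) (x : ℤ → ℝ) : ℤ → ℝ :=
  fun n => (F (x n, pastCarrier F (shiftBy (n - 1) x))).1

/-- The update of configuration and carrier at a single site. -/
def siteStep (F : ℝ × ℝ → ℝ × ℝ) (k : ℤ) (p : (ℤ → ℝ) × ℝ) : (ℤ → ℝ) × ℝ :=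
  (Function.update p.1 k (F (p.1 k, p.2)).1, (F (p.1 k, p.2)).2)

/-- The successive updates at the `N` sites up to `k`. -/
def sweep (F : ℝ × ℝ → ℝ × ℝ) : ℤ → ℕ → (ℤ → ℝ) × ℝ → (ℤ → ℝ) × ℝ
  | _, 0, p => p
  | k, N + 1, p => siteStep F k (sweep F (k - 1) N p)

/-- The configuration in which only the sites up to `k` have been updated. -/
noncomputable def pastStepUpTo (F : ℝ × ℝ → ℝ × ℝ) (k : ℤ) (x : ℤ → ℝ) : ℤ → ℝ :=
  fun n => if n ≤ k then pastStep F x n else x n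

/-- `F` is an involution that preserves `μ × ν`, its carrier sequence forgets its initial value,
and a carrier sequence other than the forgetful one produces a configuration without carrier. -/
structure HasForgetfulCarrier (F : ℝ × ℝ → ℝ × ℝ) (μ ν : Measure ℝ) : Prop where
  measurable : Measurable F
  involutive : Function.Involutive F
  map_prod : (μ.prod ν).map F = μ.prod ν
  sync : ∀ᵐ x ∂iidLaw μ, ∃ c, IsSync F x c
  unique : ∀ᵐ x ∂iidLaw μ, ∀ u v, IsCarrier F x u →
    IsCarrier F (fun n => (F (x n, u (n - 1))).1) v → IsSync F x (u 0)

section Pointwise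

variable {F : ℝ × ℝ → ℝ × ℝ}

theorem carrierFrom_congr (N : ℕ) (a : ℝ) {x y : ℤ → ℝ} (h : ∀ n ≤ 0, x n = y n) :
    carrierFrom F N a x = carrierFrom F N a y := by
  induction N generalizing x y with
  | zero => rfl
  | succ N ih =>
    simp only [carrierFrom]
    rw [h 0 le_rfl, ih (x := shiftBy (-1) x) (y := shiftBy (-1) y) fun n hn => h _ (by omega)]

theorem pastCarrier_congr {x y : ℤ → ℝ} (h : ∀ n ≤ 0, x n = y n) :
    pastCarrier F x = pastCarrier F y := by
  unfold pastCarrier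
  congr 1
  funext N
  exact carrierFrom_congr N 0 h

/-- Causality: the half-line up to site `0` evolves autonomously. It makes later carriers at site
`0` functions of the configuration updated up to `0`. -/
theorem pastStep_congr {x y : ℤ → ℝ} (h : ∀ n ≤ 0, x n = y n) :
    ∀ n ≤ 0, pastStep F x n = pastStep F y n := by
  intro n hn
  unfold pastStep
  rw [h n hn, pastCarrier_congr (x := shiftBy (n - 1) x) (y := shiftBy (n - 1) y) fun m hm => h _ (by omega)]

theorem IsSync.pastCarrier_eq {x : ℤ → ℝ} {c : ℝ} (h : IsSync F x c) : pastCarrier F x = c :=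
  (tendsto_const_nhds.congr' (EventuallyEq.symm (h 0))).limUnder_eq

theorem IsSync.isSync_pastCarrier {x : ℤ → ℝ} {c : ℝ} (h : IsSync F x c) :
    IsSync F x (pastCarrier F x) := h.pastCarrier_eq ▸ h

theorem eventually_atTop_of_succ {p : ℕ → Prop} (h : ∀ᶠ N in atTop, p (N + 1)) :
    ∀ᶠ N in atTop, p N := by
  obtain ⟨a, ha⟩ := eventually_atTop.1 h
  refine eventually_atTop.2 ⟨a + 1, fun N hN => ?_⟩
  obtain ⟨M, rfl⟩ := Nat.exists_eq_add_of_le' (le_trans (Nat.le_add_left 1 a) hN)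
  exact ha M (by omega)

theorem IsSync.succ {x : ℤ → ℝ} {c : ℝ} (h : IsSync F (shiftBy (-1) x) c) :
    IsSync F x (F (x 0, c)).2 := by
  intro a
  refine eventually_atTop_of_succ ?_
  filter_upwards [h a] with N hN
  rw [carrierFrom, hN]

/-- The pointwise properties of the configurations for which the dynamics is well behaved. -/
def IsTame (F : ℝ × ℝ → ℝ × ℝ) (x : ℤ → ℝ) : Prop :=
  (∀ n, ∃ c, IsSync F (shiftBy n x) c) ∧
    ∀ n, ∀ u v, IsCarrier F (shiftBy n x) u →
      IsCarrier F (fun m => (F (shiftBy n x m, u (m - 1))).1) v → IsSync F (shiftBy n x) (u 0)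

theorem IsTame.step_eq {x : ℤ → ℝ} (h : IsTame F x) (n : ℤ) :
    F (x n, pastCarrier F (shiftBy (n - 1) x)) =
      (pastStep F x n, pastCarrier F (shiftBy n x)) := by
  refine Prod.ext rfl ?_
  obtain ⟨c, hc⟩ := h.1 (n - 1)
  have hs : shiftBy (-1) (shiftBy n x) = shiftBy (n - 1) x := by
    rw [shiftBy_shiftBy]; congr 1; ring
  have h1 : IsSync F (shiftBy n x) (F (shiftBy n x 0, c)).2 := IsSync.succ (by rwa [hs])
  rw [h1.pastCarrier_eq, hc.pastCarrier_eq, shiftBy_apply, zero_add]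

theorem IsTame.isCarrier {x : ℤ → ℝ} (h : IsTame F x) :
    IsCarrier F x fun n => pastCarrier F (shiftBy n x) := fun n => by
  rw [h.step_eq]

theorem IsCarrier.shiftBy {x u : ℤ → ℝ} (h : IsCarrier F x u) (k : ℤ) :
    IsCarrier F (shiftBy k x) (shiftBy k u) := fun n => by
  have := h (n + k)
  rwa [show n + k - 1 = n - 1 + k by ring] at this

theorem IsTame.eq_pastCarrier {x u v : ℤ → ℝ} (h : IsTame F x) (hu : IsCarrier F x u)
    (hv : IsCarrier F (fun n => (F (x n, u (n - 1))).1) v) (n : ℤ) :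
    u n = pastCarrier F (shiftBy n x) := by
  have h1 := h.2 n (shiftBy n u) (shiftBy n v) (hu.shiftBy n) (by
    have := hv.shiftBy n
    convert this using 1
    funext m
    simp only [shiftBy_apply]
    rw [show m + n - 1 = m - 1 + n by ring])
  rw [h1.pastCarrier_eq, shiftBy_apply, zero_add]

/-- Each site is read before it is updated and is never revisited, so the carrier transported by the
sweep is computed from the original values. -/
theorem sweep_snd (k : ℤ) (N : ℕ) (x : ℤ → ℝ) (a : ℝ) :
    (sweep F k N (x, a)).2 = carrierFrom F N a (shiftBy k x) ∧
      ∀ n > k, (sweep F k N (x, a)).1 n = x n := by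
  induction N generalizing k with
  | zero => exact ⟨rfl, fun _ _ => rfl⟩
  | succ N ih =>
    obtain ⟨h1, h2⟩ := ih (k - 1)
    simp only [sweep, siteStep, carrierFrom]
    refine ⟨?_, fun n hn => ?_⟩
    · rw [h1, h2 k (by omega), shiftBy_shiftBy, shiftBy_apply, zero_add, neg_add_eq_sub]
    · rw [Function.update_of_ne hn.ne', h2 n (by omega)]

theorem eventually_sweep_fst {x : ℤ → ℝ} (h : IsTame F x) (a : ℝ) (m : ℕ) (k : ℤ) :
    ∀ᶠ N in atTop, (sweep F k N (x, a)).1 (k - m) = pastStep F x (k - m) := by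
  induction m generalizing k with
  | zero =>
    refine eventually_atTop_of_succ ?_
    obtain ⟨c, hc⟩ := h.1 (k - 1)
    filter_upwards [hc.isSync_pastCarrier a] with N hN
    obtain ⟨h1, h2⟩ := sweep_snd (F := F) (k - 1) N x a
    simp only [sweep, siteStep, Nat.cast_zero, sub_zero, Function.update_self]
    rw [h1, hN, h2 k (by omega), pastStep]
  | succ m ih =>
    refine eventually_atTop_of_succ ?_
    filter_upwards [ih (k - 1)] with N hN
    simp only [sweep, siteStep]
    rw [Function.update_of_ne (by omega)]
    convert hN using 2 <;> push_cast <;> ring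

/-- Every coordinate is eventually constant in `N`, because the carrier reaching it has forgotten
`a`. This carries the invariance under finite sweeps to the infinite dynamics. -/
theorem tendsto_sweep {x : ℤ → ℝ} (h : IsTame F x) (a : ℝ) (k : ℤ) :
    Tendsto (fun N => sweep F k N (x, a)) atTop
      (𝓝 (pastStepUpTo F k x, pastCarrier F (shiftBy k x))) := by
  refine Tendsto.prodMk_nhds (tendsto_pi_nhds.2 fun n => ?_) ?_
  · refine tendsto_const_nhds.congr' ?_
    rw [pastStepUpTo]
    split_ifs with hn
    · have := eventually_sweep_fst h a (k - n).toNat k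
      filter_upwards [this] with N hN
      rw [show k - ((k - n).toNat : ℤ) = n by omega] at hN
      exact hN.symm
    · exact .of_forall fun N => ((sweep_snd k N x a).2 n (not_le.1 hn)).symm
  · obtain ⟨c, hc⟩ := h.1 k
    refine tendsto_const_nhds.congr' ?_
    filter_upwards [hc.isSync_pastCarrier a] with N hN
    rw [(sweep_snd k N x a).1, hN]

theorem tendsto_pastStepUpTo (x : ℤ → ℝ) :
    Tendsto (fun k : ℕ => pastStepUpTo F k x) atTop (𝓝 (pastStep F x)) := by
  refine tendsto_pi_nhds.2 fun n => tendsto_const_nhds.congr' ?_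
  filter_upwards [eventually_ge_atTop n.toNat] with k hk
  rw [pastStepUpTo, if_pos (by omega)]

/-! ### Existence and uniqueness of lattice solutions -/

/-- The inverse of `pastStep F` on tame configurations. -/
noncomputable def pastStepBack (F : ℝ × ℝ → ℝ × ℝ) (x : ℤ → ℝ) : ℤ → ℝ :=
  reflect (pastStep F (reflect x))

/-- The integer powers of the dynamics. -/
noncomputable def pastStepPow (F : ℝ × ℝ → ℝ × ℝ) : ℤ → (ℤ → ℝ) → ℤ → ℝ
  | .ofNat n => (pastStep F)^[n]
  | .negSucc n => (pastStepBack F)^[n + 1]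

/-- A set of tame configurations that is stable under the dynamics and under reflection. -/
structure IsTameSet (F : ℝ × ℝ → ℝ × ℝ) (G : Set (ℤ → ℝ)) : Prop where
  involutive : Function.Involutive F
  tame : ∀ x ∈ G, IsTame F x
  pastStep_mem : ∀ x ∈ G, pastStep F x ∈ G
  reflect_mem : ∀ x ∈ G, reflect x ∈ G

namespace IsTameSet

variable {G : Set (ℤ → ℝ)} (hG : IsTameSet F G)
include hG

/-- The row `us (t + 1)` is a carrier of the updated configuration, which is what tameness requires
to rule out a carrier other than the one from the far past. -/
theorem eq_of_isLatticeSolution_succ {x : ℤ → ℝ} {xs us : ℤ → ℤ → ℝ}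
    (h : IsLatticeSolution F x xs us) {t : ℤ} (ht : xs t ∈ G) :
    xs (t + 1) = pastStep F (xs t) ∧ ∀ n, us t n = pastCarrier F (shiftBy n (xs t)) := by
  have hc : ∀ n, us t n = pastCarrier F (shiftBy n (xs t)) := by
    refine (hG.tame _ ht).eq_pastCarrier (v := us (t + 1)) (fun n => by rw [h.1]) fun n => ?_
    simp only [h.1]
  refine ⟨funext fun n => ?_, hc⟩
  rw [pastStep, ← hc, h.1]

/-- Reversing space and time maps lattice solutions to lattice solutions. -/
theorem isLatticeSolution_reverse {x : ℤ → ℝ} {xs us : ℤ → ℤ → ℝ}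
    (h : IsLatticeSolution F x xs us) :
    IsLatticeSolution F (reflect x) (fun t => reflect (xs (-t)))
      fun t n => us (-t - 1) (-n - 1) := by
  refine ⟨fun n t => ?_, fun n => by simp [h.2]⟩
  -- Applying the involution `F` gives `F (x_n^{t+1}, u_n^t) = (x_n^t, u_{n-1}^t)`. A carrier lives
  -- between two sites and between two times, hence the offset `-1` in both reversed indices.
  have h1 := h.1 (-n) (-t - 1)
  rw [show -t - 1 + 1 = -t by ring] at h1
  have h2 := congrArg F h1
  rw [hG.involutive] at h2
  simp only [reflect_apply]
  rw [show -(n - 1) - 1 = -n by ring, ← h2, show -(t + 1) = -t - 1 by ring]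

/-- The carriers of `x`, read backward, form a carrier of the reflected image `w` with output
`reflect x`. That output is tame and so has a carrier; tameness of `w` then identifies this carrier
with the one used by `pastStep`. -/
theorem pastStepBack_pastStep {x : ℤ → ℝ} (hx : x ∈ G) : pastStepBack F (pastStep F x) = x := by
  have h := hG.tame x hx
  have hw := hG.tame _ (hG.reflect_mem _ (hG.pastStep_mem x hx))
  have hr := hG.tame _ (hG.reflect_mem x hx)
  set w := reflect (pastStep F x)
  have hstep : ∀ n, F (w n, pastCarrier F (shiftBy (-(n - 1) - 1) x)) =
      (reflect x n, pastCarrier F (shiftBy (-n - 1) x)) := by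
    intro n
    have h1 := congrArg F (h.step_eq (-n))
    rw [hG.involutive] at h1
    rw [show -(n - 1) - 1 = -n by ring]
    exact h1.symm
  have hu := hw.eq_pastCarrier (u := fun n => pastCarrier F (shiftBy (-n - 1) x))
    (v := fun n => pastCarrier F (shiftBy n (reflect x))) (fun n => by rw [hstep])
    (by simp only [hstep]; exact hr.isCarrier)
  have : pastStep F w = reflect x := by
    funext n
    rw [pastStep, ← hu, hstep]
  rw [pastStepBack, this, reflect_reflect]

theorem pastStepBack_mem {x : ℤ → ℝ} (hx : x ∈ G) : pastStepBack F x ∈ G :=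
  hG.reflect_mem _ (hG.pastStep_mem _ (hG.reflect_mem _ hx))

theorem pastStep_pastStepBack {x : ℤ → ℝ} (hx : x ∈ G) : pastStep F (pastStepBack F x) = x := by
  have h := hG.pastStepBack_pastStep (hG.reflect_mem _ hx)
  rw [pastStepBack] at h
  rw [pastStepBack, ← reflect_reflect (pastStep F (reflect _)), h, reflect_reflect]

omit hG in
@[simp] theorem pastStepPow_zero (x : ℤ → ℝ) : pastStepPow F 0 x = x := rfl

theorem pastStepPow_mem {x : ℤ → ℝ} (hx : x ∈ G) (t : ℤ) : pastStepPow F t x ∈ G := by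
  cases t with
  | ofNat n =>
    exact (show MapsTo (pastStep F) G G from hG.pastStep_mem).iterate n hx
  | negSucc n =>
    exact (show MapsTo (pastStepBack F) G G from fun _ h => hG.pastStepBack_mem h).iterate _ hx

theorem pastStepPow_add_one {x : ℤ → ℝ} (hx : x ∈ G) (t : ℤ) :
    pastStepPow F (t + 1) x = pastStep F (pastStepPow F t x) := by
  cases t with
  | ofNat n => exact Function.iterate_succ_apply' _ _ _
  | negSucc n =>
    have hm : (pastStepBack F)^[n] x ∈ G :=
      (show MapsTo (pastStepBack F) G G from fun _ h => hG.pastStepBack_mem h).iterate _ hx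
    have h1 : pastStep F (pastStepPow F (.negSucc n) x) = (pastStepBack F)^[n] x := by
      rw [pastStepPow, Function.iterate_succ_apply', hG.pastStep_pastStepBack hm]
    rw [h1]
    cases n with
    | zero => rfl
    | succ n => rfl

theorem pastStepPow_sub_one {x : ℤ → ℝ} (hx : x ∈ G) (t : ℤ) :
    pastStepPow F (t - 1) x = pastStepBack F (pastStepPow F t x) := by
  have := hG.pastStepPow_add_one hx (t - 1)
  rw [sub_add_cancel] at this
  rw [this, hG.pastStepBack_pastStep (hG.pastStepPow_mem hx _)]

theorem pastStepPow_add {x : ℤ → ℝ} (hx : x ∈ G) (s t : ℤ) :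
    pastStepPow F (s + t) x = pastStepPow F s (pastStepPow F t x) := by
  have ht := hG.pastStepPow_mem hx t
  induction s using Int.induction_on with
  | zero => simp
  | succ s ih =>
    rw [show (s : ℤ) + 1 + t = s + t + 1 by ring, hG.pastStepPow_add_one hx,
      hG.pastStepPow_add_one ht, ih]
  | pred s ih =>
    rw [show -(s : ℤ) - 1 + t = -s + t - 1 by ring, hG.pastStepPow_sub_one hx,
      hG.pastStepPow_sub_one ht, ih]

theorem isLatticeSolution {x : ℤ → ℝ} (hx : x ∈ G) :
    IsLatticeSolution F x (fun t => pastStepPow F t x)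
      fun t n => pastCarrier F (shiftBy n (pastStepPow F t x)) := by
  refine ⟨fun n t => ?_, fun n => rfl⟩
  beta_reduce
  rw [hG.pastStepPow_add_one hx]
  exact (hG.tame _ (hG.pastStepPow_mem hx t)).step_eq n

theorem eq_pastStepPow {x : ℤ → ℝ} {xs us : ℤ → ℤ → ℝ} (hx : x ∈ G)
    (h : IsLatticeSolution F x xs us) (t : ℤ) : xs t = pastStepPow F t x := by
  induction t using Int.induction_on with
  | zero => exact funext h.2
  | succ t ih =>
    rw [hG.pastStepPow_add_one hx, ← ih]
    exact (hG.eq_of_isLatticeSolution_succ h (ih ▸ hG.pastStepPow_mem hx _)).1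
  | pred t ih =>
    have hm : xs (-t) ∈ G := ih ▸ hG.pastStepPow_mem hx _
    have h1 := (hG.eq_of_isLatticeSolution_succ (hG.isLatticeSolution_reverse h) (t := t)
      (hG.reflect_mem _ hm)).1
    rw [hG.pastStepPow_sub_one hx, ← ih, pastStepBack, ← h1, reflect_reflect, neg_add']

theorem eq_pastCarrier {x : ℤ → ℝ} {xs us : ℤ → ℤ → ℝ} (hx : x ∈ G)
    (h : IsLatticeSolution F x xs us) (t n : ℤ) :
    us t n = pastCarrier F (shiftBy n (pastStepPow F t x)) := by
  have h1 := hG.eq_pastStepPow hx h t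
  rw [← h1]
  exact (hG.eq_of_isLatticeSolution_succ h (h1 ▸ hG.pastStepPow_mem hx t)).2 n

theorem mem_uniqueIVP {x : ℤ → ℝ} (hx : x ∈ G) : x ∈ uniqueIVP F :=
  ⟨(_, _), hG.isLatticeSolution hx, fun _ hp => Prod.ext
    (funext fun t => hG.eq_pastStepPow hx hp t)
    (funext fun t => funext fun n => hG.eq_pastCarrier hx hp t n)⟩

theorem latticeStep_eq {x : ℤ → ℝ} (hx : x ∈ G) : latticeStep F x = pastStep F x := by
  rw [latticeStep, dif_pos (hG.mem_uniqueIVP hx)]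
  exact hG.eq_pastStepPow hx (Classical.choose_spec (hG.mem_uniqueIVP hx).exists) 1

/-- The carriers at site `0` over time. -/
theorem pastCarrier_pastStep {x : ℤ → ℝ} (hx : x ∈ G) :
    (fun t => pastCarrier F (pastStepPow F t (pastStep F x))) =
      shiftBy 1 fun t => pastCarrier F (pastStepPow F t x) := by
  funext t
  rw [shiftBy_apply, hG.pastStepPow_add hx]
  rfl

end IsTameSet

/-- The map with the roles of configuration and carrier exchanged. -/
def swapMap (F : ℝ × ℝ → ℝ × ℝ) (p : ℝ × ℝ) : ℝ × ℝ := (F p.swap).swap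

/-- A configuration is recovered from the evolution of the carrier at site `0`. -/
theorem pastCarrier_swapMap_eq {G G' : Set (ℤ → ℝ)} (hG : IsTameSet F G)
    (hG' : IsTameSet (swapMap F) G') {x : ℤ → ℝ} (hx : x ∈ G)
    (hΦ : (fun t => pastCarrier F (pastStepPow F t x)) ∈ G') (n : ℤ) :
    pastCarrier (swapMap F) (shiftBy (-1)
      (pastStepPow (swapMap F) (n - 1) fun t => pastCarrier F (pastStepPow F t x))) = x n := by
  -- The transposed lattice: carriers become configurations and conversely. The carrier at `a`
  -- enters site `a + 1`, which causes the shifts by one; `x n` is then the transposed carrier at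
  -- time `n - 1` and site `-1`.
  have hsol : IsLatticeSolution (swapMap F) (fun t => pastCarrier F (pastStepPow F t x))
      (fun a b => pastCarrier F (shiftBy a (pastStepPow F b x)))
      (fun a b => pastStepPow F (b + 1) x (a + 1)) := by
    refine ⟨fun b a => ?_, fun b => by simp only [shiftBy_zero]⟩
    beta_reduce
    have h := (hG.tame _ (hG.pastStepPow_mem hx b)).step_eq (a + 1)
    rw [add_sub_cancel_right] at h
    rw [sub_add_cancel, hG.pastStepPow_add_one hx]
    exact congrArg Prod.swap h
  have := hG'.eq_pastCarrier hΦ hsol (n - 1) (-1)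
  simpa using this.symm

end Pointwise

section Measurability

variable {F : ℝ × ℝ → ℝ × ℝ} (hF : Measurable F)
include hF

theorem measurable_carrierFrom (N : ℕ) (a : ℝ) : Measurable (carrierFrom F N a) := by
  induction N with
  | zero => exact measurable_const
  | succ N ih =>
    exact measurable_snd.comp (hF.comp
      ((measurable_pi_apply 0).prodMk (ih.comp (measurable_shiftBy _))))

theorem measurable_pastCarrier : Measurable (pastCarrier F) :=
  (StronglyMeasurable.limUnder
    fun N => (measurable_carrierFrom hF N 0).stronglyMeasurable).measurable

theorem measurable_pastStep : Measurable (pastStep F) :=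
  measurable_pi_lambda _ fun n => measurable_fst.comp (hF.comp ((measurable_pi_apply n).prodMk
    ((measurable_pastCarrier hF).comp (measurable_shiftBy _))))

theorem measurable_pastStepBack : Measurable (pastStepBack F) :=
  measurable_reflect.comp ((measurable_pastStep hF).comp measurable_reflect)

theorem measurable_pastStepPow (t : ℤ) : Measurable (pastStepPow F t) := by
  cases t with
  | ofNat n => exact (measurable_pastStep hF).iterate n
  | negSucc n => exact (measurable_pastStepBack hF).iterate _

theorem measurable_pastStepUpTo (k : ℤ) : Measurable (pastStepUpTo F k) := by
  refine measurable_pi_lambda _ fun n => ?_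
  unfold pastStepUpTo
  split_ifs
  · exact (measurable_pi_apply n).comp (measurable_pastStep hF)
  · exact measurable_pi_apply n

theorem measurable_pastStepUpTo_pastCarrier (k : ℤ) :
    Measurable fun x => (pastStepUpTo F k x, pastCarrier F (shiftBy k x)) :=
  (measurable_pastStepUpTo hF k).prodMk ((measurable_pastCarrier hF).comp (measurable_shiftBy k))

end Measurability

/-! ### Invariance and ergodicity from a forgetful carrier -/

/-- A property that holds almost surely holds on an almost sure set that is stable under
countably many quasi-measure-preserving maps. -/
theorem exists_stable_of_ae {Ω ι : Type*} [MeasurableSpace Ω] [Countable ι] {P : Measure Ω}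
    {f : ι → Ω → Ω} (hf : ∀ i, Measure.QuasiMeasurePreserving (f i) P P) {p : Ω → Prop}
    (hp : ∀ᵐ x ∂P, p x) :
    ∃ G : Set Ω, (∀ᵐ x ∂P, x ∈ G) ∧ (∀ x ∈ G, p x) ∧ ∀ i, ∀ x ∈ G, f i x ∈ G := by
  -- Lists encode all finite compositions of the maps, so only countably many almost sure conditions
  -- are imposed.
  refine ⟨{x | ∀ l : List ι, p (l.foldr (fun i y => f i y) x)}, ?_, fun x hx => hx [],
    fun i x hx l => by simpa using hx (l ++ [i])⟩
  refine ae_all_iff.2 fun l => ?_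
  have : Measure.QuasiMeasurePreserving (fun x => l.foldr (fun i y => f i y) x) P P := by
    induction l with
    | nil => exact .id P
    | cons i l ih => exact (hf i).comp ih
  exact this.ae hp

namespace HasForgetfulCarrier

variable {F : ℝ × ℝ → ℝ × ℝ} {μ ν : Measure ℝ} [IsProbabilityMeasure μ] [IsProbabilityMeasure ν]
  (h : HasForgetfulCarrier F μ ν)
include h

omit [IsProbabilityMeasure ν] in
theorem ae_isTame : ∀ᵐ x ∂iidLaw μ, IsTame F x :=
  (ae_all_iff.2 fun n => (measurePreserving_shiftBy μ n).quasiMeasurePreserving.ae h.sync).and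
    (ae_all_iff.2 fun n => (measurePreserving_shiftBy μ n).quasiMeasurePreserving.ae h.unique)

/-- After resampling the value at `k` as an independent `b`, the update is `F` acting on `(b, a)` of
law `μ × ν`, where `map_prod` applies. Formally, `siteStep` composed with the resampling map `h3`
equals `h3` composed with `id × F`. -/
theorem measurePreserving_siteStep (k : ℤ) :
    MeasurePreserving (siteStep F k) ((iidLaw μ).prod ν) ((iidLaw μ).prod ν) := by
  have hm : Measurable (siteStep F k) := by
    have h1 : Measurable fun p : (ℤ → ℝ) × ℝ => F (p.1 k, p.2) :=
      h.measurable.comp (by fun_prop)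
    exact ((measurePreserving_update (μ := μ) k).measurable.comp
      (measurable_fst.prodMk (measurable_fst.comp h1))).prodMk (measurable_snd.comp h1)
  have hF : MeasurePreserving F (μ.prod ν) (μ.prod ν) := ⟨h.measurable, h.map_prod⟩
  have h2 : MeasurePreserving (Prod.map id F) ((iidLaw μ).prod (μ.prod ν))
      ((iidLaw μ).prod (μ.prod ν)) := (MeasurePreserving.id _).prod hF
  have h3 : MeasurePreserving
      (fun p : (ℤ → ℝ) × ℝ × ℝ => (Function.update p.1 k p.2.1, p.2.2))
      ((iidLaw μ).prod (μ.prod ν)) ((iidLaw μ).prod ν) :=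
    ((measurePreserving_update (μ := μ) k).prod (MeasurePreserving.id ν)).comp
      ((measurePreserving_prodAssoc (iidLaw μ) μ ν).symm MeasurableEquiv.prodAssoc)
  refine ⟨hm, ?_⟩
  conv_lhs => rw [← h3.map_eq]
  rw [Measure.map_map hm h3.measurable, ← (h3.comp h2).map_eq]
  congr 1
  funext ⟨x, b, a⟩
  simp [siteStep]

theorem measurePreserving_sweep (k : ℤ) (N : ℕ) :
    MeasurePreserving (sweep F k N) ((iidLaw μ).prod ν) ((iidLaw μ).prod ν) := by
  induction N generalizing k with
  | zero => exact MeasurePreserving.id _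
  | succ N ih => exact (h.measurePreserving_siteStep k).comp (ih (k - 1))

/-- The carrier at `k` is independent of the configuration updated up to `k`. -/
theorem map_pastStepUpTo_pastCarrier (k : ℤ) :
    (iidLaw μ).map (fun x => (pastStepUpTo F k x, pastCarrier F (shiftBy k x))) =
      (iidLaw μ).prod ν := by
  have hm := measurable_pastStepUpTo_pastCarrier h.measurable k
  have h1 : ((iidLaw μ).prod ν).map
      (fun p => (pastStepUpTo F k p.1, pastCarrier F (shiftBy k p.1))) = (iidLaw μ).prod ν := by
    -- An auxiliary independent carrier of law `ν` starts each sweep; every finite sweep has the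
    -- exact law, and the limit no longer depends on the auxiliary variable.
    refine map_eq_of_tendsto_of_map_eq (X := fun N p => sweep F k N p)
      (fun N => (h.measurePreserving_sweep k N).measurable) (hm.comp measurable_fst)
      (fun N => (h.measurePreserving_sweep k N).map_eq) ?_
    filter_upwards [Measure.quasiMeasurePreserving_fst.ae h.ae_isTame] with p hp
    exact tendsto_sweep hp p.2 k
  have h2 := Measure.map_map (μ := (iidLaw μ).prod ν) hm measurable_fst
  rw [measurePreserving_fst.map_eq] at h2
  rw [h2]
  exact h1

theorem measurePreserving_pastStep : MeasurePreserving (pastStep F) (iidLaw μ) (iidLaw μ) := by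
  refine ⟨measurable_pastStep h.measurable, ?_⟩
  refine map_eq_of_tendsto_of_map_eq (X := fun (k : ℕ) x => pastStepUpTo F k x)
    (fun k => measurable_pastStepUpTo h.measurable k) (measurable_pastStep h.measurable)
    (fun k => ?_) (.of_forall fun x => tendsto_pastStepUpTo x)
  have h1 := congrArg (Measure.map Prod.fst) (h.map_pastStepUpTo_pastCarrier k)
  rw [Measure.map_map measurable_fst (measurable_pastStepUpTo_pastCarrier h.measurable k),
    measurePreserving_fst.map_eq] at h1
  exact h1

theorem measurePreserving_pastStepPow (t : ℤ) :
    MeasurePreserving (pastStepPow F t) (iidLaw μ) (iidLaw μ) := by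
  have hb : MeasurePreserving (pastStepBack F) (iidLaw μ) (iidLaw μ) :=
    (measurePreserving_reflect μ).comp
      (h.measurePreserving_pastStep.comp (measurePreserving_reflect μ))
  cases t with
  | ofNat n => exact h.measurePreserving_pastStep.iterate n
  | negSucc n => exact hb.iterate _

theorem exists_isTameSet : ∃ G, (∀ᵐ x ∂iidLaw μ, x ∈ G) ∧ IsTameSet F G := by
  obtain ⟨G, h1, h2, h3⟩ := exists_stable_of_ae (P := iidLaw μ)
    (f := fun b : Bool => if b then pastStep F else reflect) (fun b => by
      cases b
      · exact (measurePreserving_reflect μ).quasiMeasurePreserving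
      · exact h.measurePreserving_pastStep.quasiMeasurePreserving) h.ae_isTame
  exact ⟨G, h1, h.involutive, h2, h3 true, h3 false⟩

/-- The carriers at site `0` at successive times are independent with law `ν`. -/
theorem iidLaw_forall_pastCarrier_mem (n : ℕ) {t : ℕ → Set ℝ} (ht : ∀ i, MeasurableSet (t i)) :
    iidLaw μ {x | ∀ i < n, pastCarrier F ((pastStep F)^[i] x) ∈ t i} =
      ∏ i ∈ Finset.range n, ν (t i) := by
  induction n generalizing t with
  | zero => simp
  | succ n ih =>
    have hC : MeasurableSet {x | ∀ i < n, pastCarrier F ((pastStep F)^[i] x) ∈ t (i + 1)} := by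
      have : {x | ∀ i < n, pastCarrier F ((pastStep F)^[i] x) ∈ t (i + 1)} =
          ⋂ i ∈ Finset.range n, (fun x => pastCarrier F ((pastStep F)^[i] x)) ⁻¹' t (i + 1) := by
        ext; simp
      rw [this]
      exact Finset.measurableSet_biInter _ fun i _ => ((measurable_pastCarrier h.measurable).comp
        ((measurable_pastStep h.measurable).iterate i)) (ht _)
    have hiter : ∀ (i : ℕ) {x y : ℤ → ℝ}, (∀ m ≤ 0, x m = y m) →
        ∀ m ≤ 0, (pastStep F)^[i] x m = (pastStep F)^[i] y m := by
      intro i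
      induction i with
      | zero => exact fun hxy => hxy
      | succ i ihi => exact fun hxy => ihi (pastStep_congr hxy)
    -- By causality the carriers at times `1, …, n` depend only on the configuration updated up to
    -- site `0`, which is i.i.d. and independent of the carrier at time `0`. Hence one factor splits
    -- off and the induction applies.
    have hset : {x | ∀ i < n + 1, pastCarrier F ((pastStep F)^[i] x) ∈ t i} =
        (fun x => (pastStepUpTo F 0 x, pastCarrier F (shiftBy 0 x))) ⁻¹'
          ({x | ∀ i < n, pastCarrier F ((pastStep F)^[i] x) ∈ t (i + 1)} ×ˢ t 0) := by
      ext x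
      have : ∀ i, pastCarrier F ((pastStep F)^[i] (pastStepUpTo F 0 x)) =
          pastCarrier F ((pastStep F)^[i + 1] x) := fun i =>
        pastCarrier_congr (hiter i fun m hm => if_pos hm)
      simp only [mem_ofPred_eq, mem_preimage, mem_prod, this, shiftBy_zero]
      constructor
      · exact fun hx => ⟨fun i hi => hx (i + 1) (by omega), hx 0 (by omega)⟩
      · rintro ⟨hx, hx0⟩ (_ | i) hi
        · exact hx0
        · exact hx i (by omega)
    have hm := measurable_pastStepUpTo_pastCarrier h.measurable 0
    rw [hset, ← Measure.map_apply hm (hC.prod (ht 0)), h.map_pastStepUpTo_pastCarrier,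
      Measure.prod_prod, ih fun i => ht (i + 1), Finset.prod_range_succ']

/-- The evolution of the carrier at site `0` is an i.i.d. sequence with marginal `ν`. -/
theorem measurePreserving_pastCarrier_pastStepPow :
    MeasurePreserving (fun x t => pastCarrier F (pastStepPow F t x)) (iidLaw μ) (iidLaw ν) := by
  have hm : Measurable fun x t => pastCarrier F (pastStepPow F t x) :=
    measurable_pi_lambda _ fun t =>
      (measurable_pastCarrier h.measurable).comp (measurable_pastStepPow h.measurable t)
  refine ⟨hm, Measure.eq_infinitePi (fun _ : ℤ => ν) fun s t ht => ?_⟩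
  classical
  obtain ⟨G, hGae, hG⟩ := h.exists_isTameSet
  obtain ⟨a, ha⟩ := s.bddAbove
  obtain ⟨b, hb⟩ := s.bddBelow
  -- The times in `s` lie in a window of length `n` starting at `b`. Invariance under `pastStepPow F
  -- b` moves the window to start at `0`, and the times not in `s` get the trivial constraint
  -- `univ`.
  set n : ℕ := (a - b).toNat + 1 with hn
  have hsn : ∀ i ∈ s, 0 ≤ i - b ∧ (i - b).toNat < n := by
    intro i hi
    have h1 := ha hi
    have h2 := hb hi
    omega
  set t' : ℕ → Set ℝ := fun k => if (k : ℤ) + b ∈ s then t (k + b) else univ with ht'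
  have ht'm : ∀ k, MeasurableSet (t' k) := fun k => by
    simp only [ht']; split_ifs <;> simp [ht]
  have hset : (fun x t => pastCarrier F (pastStepPow F t x)) ⁻¹' ((s : Set ℤ).pi t)
      =ᵐ[iidLaw μ] pastStepPow F b ⁻¹'
        {x | ∀ i < n, pastCarrier F ((pastStep F)^[i] x) ∈ t' i} := by
    refine eventuallyEq_set.2 ?_
    filter_upwards [hGae] with x hx
    simp only [mem_preimage, Set.mem_pi, mem_ofPred_eq, Finset.mem_coe]
    have hpow : ∀ k : ℕ, (pastStep F)^[k] (pastStepPow F b x) = pastStepPow F (k + b) x :=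
      fun k => (hG.pastStepPow_add hx k b).symm
    simp only [hpow, ht']
    constructor
    · intro hx k _
      split_ifs with hk
      · exact hx _ hk
      · trivial
    · intro hx i hi
      obtain ⟨h1, h2⟩ := hsn i hi
      have h3 := hx (i - b).toNat h2
      rw [Int.toNat_of_nonneg h1, sub_add_cancel, if_pos hi] at h3
      exact h3
  have hmeas : MeasurableSet {x | ∀ i < n, pastCarrier F ((pastStep F)^[i] x) ∈ t' i} := by
    have : {x | ∀ i < n, pastCarrier F ((pastStep F)^[i] x) ∈ t' i} =
        ⋂ i ∈ Finset.range n, (fun x => pastCarrier F ((pastStep F)^[i] x)) ⁻¹' t' i := by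
      ext; simp
    rw [this]
    exact Finset.measurableSet_biInter _ fun i _ => ((measurable_pastCarrier h.measurable).comp
      ((measurable_pastStep h.measurable).iterate i)) (ht'm _)
  rw [Measure.map_apply hm (MeasurableSet.pi s.countable_toSet fun i _ => ht i),
    measure_congr hset, (h.measurePreserving_pastStepPow b).measure_preimage
      hmeas.nullMeasurableSet, h.iidLaw_forall_pastCarrier_mem n ht'm]
  have hinj : ∀ i ∈ s, ∀ j ∈ s, (i - b).toNat = (j - b).toNat → i = j := by
    intro i hi j hj hij
    have h1 := (hsn i hi).1
    have h2 := (hsn j hj).1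
    omega
  have himg : s.image (fun i => (i - b).toNat) ⊆ Finset.range n := by
    intro k hk
    obtain ⟨i, hi, rfl⟩ := Finset.mem_image.1 hk
    exact Finset.mem_range.2 (hsn i hi).2
  rw [← Finset.prod_subset himg, Finset.prod_image hinj]
  · refine Finset.prod_congr rfl fun i hi => ?_
    simp only [ht']
    rw [Int.toNat_of_nonneg (hsn i hi).1, sub_add_cancel, if_pos hi]
  · intro k _ hk
    have : (k : ℤ) + b ∉ s := fun hks => hk (Finset.mem_image.2 ⟨_, hks, by simp⟩)
    simp only [ht', if_neg this, measure_univ]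

theorem ae_mem_uniqueIVP : ∀ᵐ x ∂iidLaw μ, x ∈ uniqueIVP F := by
  obtain ⟨G, hGae, hG⟩ := h.exists_isTameSet
  filter_upwards [hGae] with x hx using hG.mem_uniqueIVP hx

/-- The dynamics is isomorphic to a shift of an i.i.d. sequence, hence ergodic. -/
theorem isErgodicUnder_latticeStep (h' : HasForgetfulCarrier (swapMap F) ν μ) :
    IsErgodicUnder (latticeStep F) (iidLaw μ) := by
  obtain ⟨G, hGae, hG⟩ := h.exists_isTameSet
  obtain ⟨G', hGae', hG'⟩ := h'.exists_isTameSet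
  have hstep : latticeStep F =ᵐ[iidLaw μ] pastStep F := by
    filter_upwards [hGae] with x hx using hG.latticeStep_eq hx
  have hT := h.measurePreserving_pastStep
  refine ⟨⟨_, hT.measurable, hstep⟩, by rw [Measure.map_congr hstep, hT.map_eq], ?_⟩
  intro s hs hinv
  have hinv' : ∀ᵐ x ∂iidLaw μ, pastStep F x ∈ s ↔ x ∈ s := by
    filter_upwards [hstep, eventuallyEq_set.1 hinv] with x h1 h2
    rw [← h1]; exact h2
  set Φ : (ℤ → ℝ) → ℤ → ℝ := fun x t => pastCarrier F (pastStepPow F t x) with hΦ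
  have hΦm : MeasurePreserving Φ (iidLaw μ) (iidLaw ν) := h.measurePreserving_pastCarrier_pastStepPow
  set Ψ : (ℤ → ℝ) → ℤ → ℝ := fun v n => pastCarrier (swapMap F) (shiftBy (-1)
    (pastStepPow (swapMap F) (n - 1) v)) with hΨ
  have hΨm : Measurable Ψ := measurable_pi_lambda _ fun n =>
    (measurable_pastCarrier h'.measurable).comp ((measurable_shiftBy _).comp
      (measurable_pastStepPow h'.measurable _))
  -- Since `Φ` is almost surely inverted by `Ψ` and turns `pastStep F` into the unit shift,
  -- invariant sets transfer to shift-invariant ones.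
  have hinverse : ∀ᵐ x ∂iidLaw μ, Ψ (Φ x) = x := by
    filter_upwards [hGae, hΦm.quasiMeasurePreserving.ae hGae'] with x hx hx'
    exact funext fun n => pastCarrier_swapMap_eq hG hG' hx hx' n
  have hA : MeasurableSet (Ψ ⁻¹' s) := hΨm hs
  have hAinv : shiftBy 1 ⁻¹' (Ψ ⁻¹' s) =ᵐ[iidLaw ν] Ψ ⁻¹' s := by
    rw [← measure_symmDiff_eq_zero_iff, ← hΦm.measure_preimage
      (((measurable_shiftBy 1 hA).symmDiff hA)).nullMeasurableSet]
    refine measure_mono_null (fun x hx => ?_) (ae_iff.1 (hinverse.and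
      ((hT.quasiMeasurePreserving.ae hinverse).and (hinv'.and hGae))))
    rintro ⟨h1, h2, h3, h4⟩
    have h5 : Φ (pastStep F x) = shiftBy 1 (Φ x) := hG.pastCarrier_pastStep h4
    rw [h5] at h2
    have : x ∉ Φ ⁻¹' symmDiff (shiftBy 1 ⁻¹' (Ψ ⁻¹' s)) (Ψ ⁻¹' s) := by
      simp only [mem_preimage, mem_symmDiff, h1, h2]
      tauto
    exact this hx
  have hsA : s =ᵐ[iidLaw μ] Φ ⁻¹' (Ψ ⁻¹' s) := by
    refine eventuallyEq_set.2 ?_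
    filter_upwards [hinverse] with x hx
    simp only [mem_preimage, hx]
  rcases (ergodic_shiftBy_one (μ := ν)).quasiErgodic.ae_empty_or_univ₀ hA.nullMeasurableSet hAinv
    with hA0 | hA1
  · left
    rw [measure_congr hsA, hΦm.measure_preimage hA.nullMeasurableSet, ae_eq_empty.1 hA0]
  · right
    rw [measure_congr hsA.compl, ← preimage_compl,
      hΦm.measure_preimage hA.compl.nullMeasurableSet, ae_eq_univ.1 hA1]

end HasForgetfulCarrier

/-! ### Reset blocks -/

section Blocks

variable {F : ℝ × ℝ → ℝ × ℝ}

theorem carrierFrom_add (N M : ℕ) (a : ℝ) (x : ℤ → ℝ) :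
    carrierFrom F (N + M) a x = carrierFrom F N (carrierFrom F M a (shiftBy (-N) x)) x := by
  induction N generalizing x with
  | zero => simp [carrierFrom]
  | succ N ih =>
    rw [show N + 1 + M = N + M + 1 by ring, carrierFrom, ih, carrierFrom, shiftBy_shiftBy]
    congr 7
    push_cast; ring

theorem IsCarrier.eq_carrierFrom {x u : ℤ → ℝ} (h : IsCarrier F x u) (N : ℕ) :
    u 0 = carrierFrom F N (u (-N)) x := by
  induction N generalizing x u with
  | zero => rfl
  | succ N ih =>
    have h1 := ih (h.shiftBy (-1))
    rw [shiftBy_apply, shiftBy_apply, zero_add] at h1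
    rw [carrierFrom, ← h 0, zero_sub, h1, Nat.cast_succ, neg_add]

/-- Along `L` successive values in `B`, the carrier forgets its initial value. -/
def IsResetBlock (F : ℝ × ℝ → ℝ × ℝ) (B : Set ℝ) (L : ℕ) : Prop :=
  ∀ x : ℤ → ℝ, (∀ i < L, x (-i) ∈ B) → ∀ a b, carrierFrom F L a x = carrierFrom F L b x

/-- Past the block the carrier is the same for all earlier values. This covers finite starts, hence
`IsSync`, as well as bi-infinite carriers, hence uniqueness of the carrier. -/
theorem IsResetBlock.exists_isSync {B : Set ℝ} {L : ℕ} (hB : IsResetBlock F B L) {x : ℤ → ℝ}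
    {n : ℕ} (hx : ∀ i < L, x (-n - i) ∈ B) :
    ∃ c, IsSync F x c ∧ ∀ u, IsCarrier F x u → u 0 = c := by
  have key : ∀ a, carrierFrom F (n + L) a x = carrierFrom F (n + L) 0 x := by
    intro a
    rw [carrierFrom_add, carrierFrom_add, hB (shiftBy (-n) x) (fun i hi => ?_) a 0]
    have := hx i hi
    rwa [shiftBy_apply, add_comm, ← sub_eq_add_neg]
  refine ⟨carrierFrom F (n + L) 0 x, fun a => ?_, fun u hu => ?_⟩
  · filter_upwards [eventually_ge_atTop (n + L)] with N hN
    obtain ⟨M, rfl⟩ := Nat.exists_eq_add_of_le hN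
    rw [carrierFrom_add, key]
  · rw [hu.eq_carrierFrom (n + L), key]

variable {μ : Measure ℝ} [IsProbabilityMeasure μ] {B : Set ℝ} {L : ℕ}

theorem IsResetBlock.ae_exists_isSync (hB : IsResetBlock F B L) (hBm : MeasurableSet B)
    (hpos : 0 < μ B) :
    ∀ᵐ x ∂iidLaw μ, ∃ c, IsSync F x c ∧ ∀ u, IsCarrier F x u → u 0 = c := by
  filter_upwards [ae_exists_block hBm hpos L] with x hx
  obtain ⟨n, hn⟩ := hx
  exact hB.exists_isSync hn

theorem IsResetBlock.hasForgetfulCarrier (hB : IsResetBlock F B L) (hBm : MeasurableSet B)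
    (hpos : 0 < μ B) {ν : Measure ℝ} (hF : Measurable F) (hinv : Function.Involutive F)
    (hmap : (μ.prod ν).map F = μ.prod ν) : HasForgetfulCarrier F μ ν where
  measurable := hF
  involutive := hinv
  map_prod := hmap
  sync := by
    filter_upwards [hB.ae_exists_isSync hBm hpos] with x ⟨c, hc, _⟩ using ⟨c, hc⟩
  unique := by
    filter_upwards [hB.ae_exists_isSync hBm hpos] with x ⟨c, hc, huc⟩ u v hu _
    rwa [huc u hu]

theorem IsResetBlock.ae_mem_uniqueCarrier (hB : IsResetBlock F B L) (hBm : MeasurableSet B)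
    (hpos : 0 < μ B) {ν : Measure ℝ} (h : HasForgetfulCarrier F μ ν) :
    ∀ᵐ x ∂iidLaw μ, x ∈ uniqueCarrier F := by
  filter_upwards [h.ae_isTame, ae_all_iff.2 fun n : ℤ =>
    (measurePreserving_shiftBy μ n).quasiMeasurePreserving.ae
      (hB.ae_exists_isSync hBm hpos)] with x hx hs
  refine ⟨_, hx.isCarrier, fun u hu => funext fun n => ?_⟩
  obtain ⟨c, hc, huc⟩ := hs n
  rw [hc.pastCarrier_eq, ← huc _ (hu.shiftBy n), shiftBy_apply, zero_add]

end Blocks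

/-! ### The map `udK` -/

theorem excess_top (s : ℝ) : excess ⊤ s = 0 := rfl

theorem excess_coe (j s : ℝ) : excess (j : WithTop ℝ) s = max (s - j) 0 := rfl

@[fun_prop] theorem measurable_excess (J : WithTop ℝ) : Measurable (excess J) := by
  induction J using WithTop.recTopCoe with
  | top => exact measurable_const
  | coe j => exact (measurable_id.sub_const j).max measurable_const

theorem measurable_udK (J K : WithTop ℝ) : Measurable (udK J K) := by
  unfold udK
  fun_prop

theorem udK_add (J K : WithTop ℝ) (p : ℝ × ℝ) : (udK J K p).1 + (udK J K p).2 = p.1 + p.2 := by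
  unfold udK; ring

/-- The exchanged amount depends only on the sum, which is conserved. -/
theorem involutive_udK (J K : WithTop ℝ) : Function.Involutive (udK J K) := by
  intro p
  have h := udK_add J K p
  rw [udK, h]
  refine Prod.ext ?_ ?_ <;> simp only [udK] <;> ring

theorem swapMap_udK (J K : WithTop ℝ) : swapMap (udK J K) = udK K J := by
  funext p
  simp only [swapMap, udK, Prod.swap, add_comm p.2 p.1]

theorem udK_self (J : WithTop ℝ) (p : ℝ × ℝ) : udK J J p = p.swap := by
  simp [udK, Prod.swap]

theorem isResetBlock_udK_self (J : WithTop ℝ) : IsResetBlock (udK J J) univ 1 := by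
  intro x _ a b
  simp [carrierFrom, udK_self]

theorem udK_snd_coe (j k x u : ℝ) : (udK j k (x, u)).2 = x - max (x + u - k) 0 + max (x + u - j) 0 :=
  rfl

/-- Values above `j / 2 + ε` raise the carrier by at least `2 * ε` per site, until the sum reaches
`k` and the carrier saturates at `x 0 + (k - j)`, which no longer involves its past. About `(k - j)
/ (2 * ε)` sites suffice. -/
theorem isResetBlock_udK_ge {j k ε : ℝ} (hjk : j < k) (hε : 0 < ε) :
    ∃ L, IsResetBlock (udK j k) (Ici (j / 2 + ε)) L := by
  have key : ∀ (N : ℕ) (x : ℤ → ℝ) (a : ℝ), (∀ i < N + 1, x (-i) ∈ Ici (j / 2 + ε)) →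
      carrierFrom (udK j k) (N + 1) a x = x 0 + (k - j) ∨
      j / 2 + ε + 2 * ε * N ≤ carrierFrom (udK j k) (N + 1) a x := by
    intro N
    induction N with
    | zero =>
      intro x a hx
      have h0 : j / 2 + ε ≤ x 0 := by simpa using hx 0
      right
      simp only [carrierFrom, udK_snd_coe]
      have : max (x 0 + a - k) 0 ≤ max (x 0 + a - j) 0 := max_le_max_right _ (by linarith)
      simp
      linarith
    | succ N ih =>
      intro x a hx
      have h0 : j / 2 + ε ≤ x 0 := by simpa using hx 0
      have h1 : j / 2 + ε ≤ x (-1) := by simpa using hx 1 (by omega)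
      have h2 := ih (shiftBy (-1) x) a fun i hi => by
        have := hx (i + 1) (by omega)
        rw [shiftBy_apply]
        convert this using 2
        push_cast; ring
      rw [carrierFrom, udK_snd_coe]
      set c := carrierFrom (udK j k) (N + 1) a (shiftBy (-1) x)
      rw [shiftBy_apply, zero_add] at h2
      have hN : 0 ≤ 2 * ε * N := by positivity
      have hc : j / 2 + ε ≤ c := by rcases h2 with h2 | h2 <;> linarith
      rw [max_eq_left (by linarith : 0 ≤ x 0 + c - j)]
      rcases le_total k (x 0 + c) with h3 | h3
      · left
        rw [max_eq_left (by linarith)]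
        ring
      · right
        rw [max_eq_right (by linarith)]
        push_cast
        rcases h2 with h2 | h2 <;> linarith
  obtain ⟨L, hL⟩ := exists_nat_ge ((k - j) / (2 * ε))
  rw [div_le_iff₀ (by positivity)] at hL
  have hfin : ∀ (x : ℤ → ℝ) (a : ℝ), (∀ i < L + 2, x (-i) ∈ Ici (j / 2 + ε)) →
      carrierFrom (udK j k) (L + 2) a x = x 0 + (k - j) := by
    intro x a hx
    have h0 : j / 2 + ε ≤ x 0 := by simpa using hx 0
    have h1 : j / 2 + ε ≤ x (-1) := by simpa using hx 1 (by omega)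
    have h2 := key L (shiftBy (-1) x) a fun i hi => by
      have := hx (i + 1) (by omega)
      rw [shiftBy_apply]
      convert this using 2
      push_cast; ring
    rw [carrierFrom, udK_snd_coe]
    set c := carrierFrom (udK j k) (L + 1) a (shiftBy (-1) x)
    rw [shiftBy_apply, zero_add] at h2
    have hc : k ≤ x 0 + c := by rcases h2 with h2 | h2 <;> linarith
    rw [max_eq_left (by linarith), max_eq_left (by linarith)]
    ring
  exact ⟨L + 2, fun x hx a b => by rw [hfin x a hx, hfin x b hx]⟩

/-- Mirror image of the previous case: the first site caps the carrier, each further one lowers it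
by at least `2 * ε`, and once the sum is at most `j` the carrier just copies `x 0`. -/
theorem isResetBlock_udK_le {j k ε : ℝ} (hjk : j < k) (hε : 0 < ε) :
    ∃ L, IsResetBlock (udK j k) (Iic (j / 2 - ε)) L := by
  have key : ∀ (N : ℕ) (x : ℤ → ℝ) (a : ℝ), (∀ i < N + 1, x (-i) ∈ Iic (j / 2 - ε)) →
      carrierFrom (udK j k) (N + 1) a x = x 0 ∨
      carrierFrom (udK j k) (N + 1) a x ≤ k - j / 2 - ε - 2 * ε * N := by
    intro N
    induction N with
    | zero =>
      intro x a hx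
      have h0 : x 0 ≤ j / 2 - ε := by simpa using hx 0
      right
      simp only [carrierFrom, udK_snd_coe]
      have : max (x 0 + a - j) 0 ≤ max (x 0 + a - k) 0 + (k - j) := by
        refine max_le ?_ ?_
        · linarith [le_max_left (x 0 + a - k) 0]
        · linarith [le_max_right (x 0 + a - k) 0]
      simp
      linarith
    | succ N ih =>
      intro x a hx
      have h0 : x 0 ≤ j / 2 - ε := by simpa using hx 0
      have h1 : x (-1) ≤ j / 2 - ε := by simpa using hx 1 (by omega)
      have h2 := ih (shiftBy (-1) x) a fun i hi => by
        have := hx (i + 1) (by omega)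
        rw [shiftBy_apply]
        convert this using 2
        push_cast; ring
      rw [carrierFrom, udK_snd_coe]
      set c := carrierFrom (udK j k) (N + 1) a (shiftBy (-1) x)
      rw [shiftBy_apply, zero_add] at h2
      have hN : 0 ≤ 2 * ε * N := by positivity
      have hc : c ≤ k - j / 2 - ε := by rcases h2 with h2 | h2 <;> linarith
      rw [max_eq_right (by linarith : x 0 + c - k ≤ 0)]
      rcases le_total (x 0 + c) j with h3 | h3
      · left
        rw [max_eq_right (by linarith)]
        ring
      · right
        rw [max_eq_left (by linarith)]
        push_cast
        rcases h2 with h2 | h2 <;> linarith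
  obtain ⟨L, hL⟩ := exists_nat_ge ((k - j) / (2 * ε))
  rw [div_le_iff₀ (by positivity)] at hL
  have hfin : ∀ (x : ℤ → ℝ) (a : ℝ), (∀ i < L + 2, x (-i) ∈ Iic (j / 2 - ε)) →
      carrierFrom (udK j k) (L + 2) a x = x 0 := by
    intro x a hx
    have h0 : x 0 ≤ j / 2 - ε := by simpa using hx 0
    have h1 : x (-1) ≤ j / 2 - ε := by simpa using hx 1 (by omega)
    have h2 := key L (shiftBy (-1) x) a fun i hi => by
      have := hx (i + 1) (by omega)
      rw [shiftBy_apply]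
      convert this using 2
      push_cast; ring
    rw [carrierFrom, udK_snd_coe]
    set c := carrierFrom (udK j k) (L + 1) a (shiftBy (-1) x)
    rw [shiftBy_apply, zero_add] at h2
    have hc : x 0 + c ≤ j := by rcases h2 with h2 | h2 <;> linarith
    rw [max_eq_right (by linarith), max_eq_right (by linarith)]
    ring
  exact ⟨L + 2, fun x hx a b => by rw [hfin x a hx, hfin x b hx]⟩

theorem eq_dirac_of_ae_eq {μ : Measure ℝ} [IsProbabilityMeasure μ] {c : ℝ}
    (h : ∀ᵐ x ∂μ, x = c) : μ = Measure.dirac c := by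
  have h1 : μ.map id = μ.map fun _ => c := Measure.map_congr h
  rwa [Measure.map_id, Measure.map_const, measure_univ, one_smul] at h1

/-- A measure other than `δ_c` charges the complement of a neighbourhood of `c`. -/
theorem exists_pos_of_ne_dirac {μ : Measure ℝ} [IsProbabilityMeasure μ] {c : ℝ}
    (h : μ ≠ Measure.dirac c) :
    ∃ ε > 0, 0 < μ (Ici (c + ε)) ∨ 0 < μ (Iic (c - ε)) := by
  by_contra! hcon
  refine h ?_
  have hn : ∀ n : ℕ, ∀ᵐ x ∂μ, x < c + 1 / (n + 1) ∧ c - 1 / (n + 1) < x := by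
    intro n
    obtain ⟨h1, h2⟩ := hcon (1 / (n + 1)) (by positivity)
    filter_upwards [measure_eq_zero_iff_ae_notMem.1 (nonpos_iff_eq_zero.1 h1),
      measure_eq_zero_iff_ae_notMem.1 (nonpos_iff_eq_zero.1 h2)] with x hx1 hx2
    exact ⟨not_le.1 hx1, not_le.1 hx2⟩
  have hae : ∀ᵐ x ∂μ, x = c := by
    filter_upwards [ae_all_iff.2 hn] with x hx
    refine le_antisymm ?_ ?_
    · refine le_of_forall_pos_lt_add fun ε hε => ?_
      obtain ⟨n, hn⟩ := exists_nat_one_div_lt hε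
      exact (hx n).1.trans (by linarith)
    · refine le_of_forall_pos_lt_add fun ε hε => ?_
      obtain ⟨n, hn⟩ := exists_nat_one_div_lt hε
      have := (hx n).2
      linarith
  exact eq_dirac_of_ae_eq hae

theorem isResetBlock_udK_coe_of_ne_dirac {j k : ℝ} (hjk : j < k) {μ : Measure ℝ}
    [IsProbabilityMeasure μ] (h : μ ≠ Measure.dirac (j / 2)) :
    ∃ B L, MeasurableSet B ∧ 0 < μ B ∧ IsResetBlock (udK j k) B L := by
  obtain ⟨ε, hε, h1 | h1⟩ := exists_pos_of_ne_dirac h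
  · obtain ⟨L, hL⟩ := isResetBlock_udK_ge hjk hε
    exact ⟨_, L, measurableSet_Ici, h1, hL⟩
  · obtain ⟨L, hL⟩ := isResetBlock_udK_le hjk hε
    exact ⟨_, L, measurableSet_Iic, h1, hL⟩

theorem carrierFrom_two (F : ℝ × ℝ → ℝ × ℝ) (a : ℝ) (x : ℤ → ℝ) :
    carrierFrom F 2 a x = (F (x 0, (F (x (-1), a)).2)).2 := rfl

theorem excess_eq_zero {K : WithTop ℝ} {s : ℝ} (h : (s : WithTop ℝ) ≤ K) : excess K s = 0 := by
  induction K using WithTop.recTopCoe with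
  | top => rfl
  | coe k =>
    have : s ≤ k := by exact_mod_cast h
    rw [excess_coe, max_eq_right (by linarith)]

/-- With the larger parameter first, a single value `x ≤ j / 2` forces the carrier below `j / 2`. At
the next site the sum is at most `j`, both excesses vanish, and the carrier copies the site. -/
theorem isResetBlock_udK_swap_le {j : ℝ} {K : WithTop ℝ} (hjK : (j : WithTop ℝ) ≤ K) :
    IsResetBlock (udK K j) (Iic (j / 2)) 2 := by
  have step (x u : ℝ) (hx : x ≤ j / 2) (hu : u ≤ j / 2) : (udK K j (x, u)).2 = x := by
    have h1 : x + u ≤ j := by linarith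
    simp only [udK]
    rw [excess_eq_zero (K := (j : WithTop ℝ)) (by exact_mod_cast h1),
      excess_eq_zero (K := K) (le_trans (by exact_mod_cast h1) hjK)]
    ring
  have first (x u : ℝ) (hx : x ≤ j / 2) : (udK K j (x, u)).2 ≤ j / 2 := by
    induction K using WithTop.recTopCoe with
    | top =>
      simp only [udK, excess_top, excess_coe]
      rcases max_cases (x + u - j) 0 with h | h <;> linarith
    | coe k =>
      have : j ≤ k := by exact_mod_cast hjK
      rw [udK_snd_coe]
      rcases max_cases (x + u - j) 0 with h | h <;> rcases max_cases (x + u - k) 0 with h' | h' <;>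
        linarith
  intro x hx a b
  have h0 : x 0 ≤ j / 2 := by simpa using hx 0 (by omega)
  have h1 : x (-1) ≤ j / 2 := by simpa using hx 1 (by omega)
  rw [carrierFrom_two, carrierFrom_two, step _ _ h0 (first _ _ h1), step _ _ h0 (first _ _ h1)]

/-- One site forces the carrier above `j / 2`; at the next the sum is at least `k`, both excesses
are active, and the carrier becomes `x 0 - (k - j)`. -/
theorem isResetBlock_udK_swap_ge {j k : ℝ} (hjk : j ≤ k) :
    IsResetBlock (udK k j) (Ici (k - j / 2)) 2 := by
  have step (x u : ℝ) (hx : k - j / 2 ≤ x) (hu : j / 2 ≤ u) :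
      (udK k j (x, u)).2 = x - (k - j) := by
    rw [udK_snd_coe, max_eq_left (by linarith), max_eq_left (by linarith)]
    ring
  have first (x u : ℝ) (hx : k - j / 2 ≤ x) : j / 2 ≤ (udK k j (x, u)).2 := by
    rw [udK_snd_coe]
    rcases max_cases (x + u - j) 0 with h | h <;> rcases max_cases (x + u - k) 0 with h' | h' <;>
      linarith
  intro x hx a b
  have h0 : k - j / 2 ≤ x 0 := by simpa using hx 0 (by omega)
  have h1 : k - j / 2 ≤ x (-1) := by simpa using hx 1 (by omega)
  rw [carrierFrom_two, carrierFrom_two, step _ _ h0 (first _ _ h1), step _ _ h0 (first _ _ h1)]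

/-! ### The carrier for `K = ∞` -/

section Lindley

variable {j : ℝ}

/-- The increments of the carrier over the `N` sites up to `0`. -/
def backwardSum (j : ℝ) (N : ℕ) (x : ℤ → ℝ) : ℝ := ∑ i ∈ Finset.range N, (2 * x (-i) - j)

theorem backwardSum_succ' (N : ℕ) (x : ℤ → ℝ) :
    backwardSum j (N + 1) x = 2 * x 0 - j + backwardSum j N (shiftBy (-1) x) := by
  unfold backwardSum
  rw [Finset.sum_range_succ', add_comm, Nat.cast_zero, neg_zero]
  refine congrArg _ (Finset.sum_congr rfl fun i _ => ?_)
  rw [shiftBy_apply, Nat.cast_succ, neg_add]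

theorem backwardSum_succ (N : ℕ) (x : ℤ → ℝ) :
    backwardSum j (N + 1) x = backwardSum j N x + (2 * x (-N) - j) :=
  Finset.sum_range_succ _ _

/-- A Lindley recursion with increments `2 * x - j` and moving barrier `x`. Unrolled, the carrier is
the maximum of `a + S_N` and of `x (-k) + S_k` for `k < N`, where `S` is `backwardSum`; the bounds
below express this. -/
theorem udK_coe_top_snd (x u : ℝ) : (udK j ⊤ (x, u)).2 = max (2 * x - j + u) x := by
  simp only [udK, excess_top, excess_coe, sub_zero]
  rw [← max_add_add_left]
  congr 1 <;> ring

theorem add_backwardSum_le_carrierFrom (N : ℕ) (a : ℝ) (x : ℤ → ℝ) :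
    a + backwardSum j N x ≤ carrierFrom (udK j ⊤) N a x := by
  induction N generalizing x with
  | zero => simp [backwardSum, carrierFrom]
  | succ N ih =>
    rw [backwardSum_succ', carrierFrom, udK_coe_top_snd]
    exact le_max_of_le_left (by linarith [ih (shiftBy (-1) x)])

theorem backwardSum_add_le_carrierFrom {N k : ℕ} (hk : k < N) (a : ℝ) (x : ℤ → ℝ) :
    x (-k) + backwardSum j k x ≤ carrierFrom (udK j ⊤) N a x := by
  induction N generalizing x k with
  | zero => omega
  | succ N ih =>
    rw [carrierFrom, udK_coe_top_snd]
    cases k with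
    | zero => exact le_max_of_le_right (by simp [backwardSum])
    | succ k =>
      have := ih (k := k) (by omega) (shiftBy (-1) x)
      rw [shiftBy_apply] at this
      rw [backwardSum_succ', Nat.cast_succ, neg_add]
      exact le_max_of_le_left (by linarith)

theorem carrierFrom_le {N : ℕ} {a M : ℝ} {x : ℤ → ℝ}
    (h1 : ∀ k < N, x (-k) + backwardSum j k x ≤ M) (h2 : a + backwardSum j N x ≤ M) :
    carrierFrom (udK j ⊤) N a x ≤ M := by
  induction N generalizing x M with
  | zero => simpa [backwardSum, carrierFrom] using h2
  | succ N ih =>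
    rw [carrierFrom, udK_coe_top_snd]
    refine max_le ?_ (by simpa [backwardSum] using h1 0 (by omega))
    have := ih (x := shiftBy (-1) x) (M := M - (2 * x 0 - j)) (fun k hk => ?_) ?_
    · linarith
    · have := h1 (k + 1) (by omega)
      rw [backwardSum_succ', Nat.cast_succ, neg_add] at this
      rw [shiftBy_apply]
      linarith
    · rw [backwardSum_succ'] at h2
      linarith

variable {C : ℝ} {x : ℤ → ℝ}

theorem exists_forall_backwardSum_le (hC : ∀ n, x n ≤ C)
    (hS : Tendsto (fun N => backwardSum j N x) atTop atBot) :
    ∃ p : ℕ, ∀ k : ℕ, x (-k) + backwardSum j k x ≤ x (-p) + backwardSum j p x := by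
  have h : Tendsto (fun k : ℕ => x (-k) + backwardSum j k x) cofinite atBot := by
    rw [Nat.cofinite_eq_atTop]
    exact tendsto_atBot_mono (fun k => add_le_add_left (hC _) _)
      (tendsto_atBot_add_const_left _ C hS)
  exact h.exists_forall_ge

/-- The start contributes `a + S_N`, which tends to `-∞`. Once it lies below the overall maximum,
attained at `p`, it has no effect. -/
theorem isSync_udK_coe_top (hS : Tendsto (fun N => backwardSum j N x) atTop atBot) {p : ℕ}
    (hp : ∀ k : ℕ, x (-k) + backwardSum j k x ≤ x (-p) + backwardSum j p x) :
    IsSync (udK j ⊤) x (x (-p) + backwardSum j p x) := by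
  intro a
  have h := (tendsto_atBot_add_const_left _ a hS).eventually_le_atBot (x (-p) + backwardSum j p x)
  filter_upwards [h, eventually_gt_atTop p] with N hN hpN
  exact le_antisymm (carrierFrom_le (fun k _ => hp k) hN) (backwardSum_add_le_carrierFrom hpN a x)

/-- A carrier that does not forget its past reflects the configuration near `-∞`, and the
reflected configuration has no carrier. -/
theorem carrier_eq_of_isCarrier_of_isCarrier (hC : ∀ n, x n ≤ C)
    (hS : Tendsto (fun N => backwardSum j N x) atTop atBot) {p : ℕ}
    (hp : ∀ k : ℕ, x (-k) + backwardSum j k x ≤ x (-p) + backwardSum j p x)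
    {u v : ℤ → ℝ} (hu : IsCarrier (udK j ⊤) x u)
    (hv : IsCarrier (udK j ⊤) (fun n => (udK j ⊤ (x n, u (n - 1))).1) v) :
    u 0 = x (-p) + backwardSum j p x := by
  have hge : x (-p) + backwardSum j p x ≤ u 0 := by
    rw [hu.eq_carrierFrom (p + 1)]
    exact backwardSum_add_le_carrierFrom (Nat.lt_succ_self p) _ x
  refine (hge.eq_or_lt).elim Eq.symm fun hlt => ?_
  exfalso
  -- A carrier strictly above the maximum owes nothing to the barrier, so its value at `0` can only
  -- come from the term `u (-N) + S_N`, for every `N`.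
  have hun : ∀ N : ℕ, u (-N) = u 0 - backwardSum j N x := by
    intro N
    have h1 := hu.eq_carrierFrom N
    have h2 := add_backwardSum_le_carrierFrom (j := j) N (u (-N)) x
    rw [← h1] at h2
    by_contra hne
    have h3 : u (-N) + backwardSum j N x < u 0 := lt_of_le_of_ne h2 fun h => hne (by linarith)
    have h4 := carrierFrom_le (j := j) (N := N) (a := u (-N)) (x := x)
      (M := max (x (-p) + backwardSum j p x) (u (-N) + backwardSum j N x))
      (fun k _ => le_max_of_le_left (hp k)) (le_max_right _ _)
    rw [← h1] at h4
    exact absurd h4 (not_le.2 (max_lt hlt h3))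
  set y : ℤ → ℝ := fun n => (udK j ⊤ (x n, u (n - 1))).1 with hy
  have hyn : ∀ N : ℕ, y (-N) = j - x (-N) := by
    intro N
    have h1 := udK_add j ⊤ (x (-N), u (-N - 1))
    rw [hu (-N)] at h1
    have h2 := hun (N + 1)
    rw [Nat.cast_succ, neg_add, ← sub_eq_add_neg, backwardSum_succ] at h2
    simp only [hy]
    linarith [hun N]
  have hSy : ∀ N, backwardSum j N y = -backwardSum j N x := by
    intro N
    unfold backwardSum
    rw [← Finset.sum_neg_distrib]
    refine Finset.sum_congr rfl fun i _ => ?_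
    rw [hyn]; ring
  -- The output on the left half-line is the reflection `j - x`, whose backward sums tend to `+∞`.
  -- Any carrier `v` would satisfy `v 0 ≥ j - C - S_N` for all `N`, and this `N` violates the bound.
  obtain ⟨N, hN⟩ := ((tendsto_neg_atBot_atTop.comp hS).eventually_gt_atTop (v 0 - j + C)).exists
  have h1 := backwardSum_add_le_carrierFrom (j := j) (Nat.lt_succ_self N) (v (-(N + 1 : ℕ))) y
  rw [← hv.eq_carrierFrom (N + 1), hyn, hSy] at h1
  simp only [Function.comp_apply] at hN
  linarith [hC (-N)]

end Lindley

/-! ### Negative drift for `K = ∞` -/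

section Drift

variable {μ : Measure ℝ} [IsProbabilityMeasure μ] {j C : ℝ}

open ProbabilityTheory in
-- Strong law for the majorant `g` of `x - j / 2`. The majorant admits marginals without a finite
-- mean, such as those supported on `(-∞, j / 2]`.
theorem ae_tendsto_backwardSum {g : ℝ → ℝ} (hg : Measurable g) (hint : Integrable g μ)
    (hneg : ∫ x, g x ∂μ < 0) (hle : ∀ᵐ x ∂μ, x - j / 2 ≤ g x) :
    ∀ᵐ x ∂iidLaw μ, Tendsto (fun N => backwardSum j N x) atTop atBot := by
  have heval : ∀ n : ℤ, MeasurePreserving (Function.eval n) (iidLaw μ) μ := fun n =>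
    measurePreserving_eval_infinitePi (fun _ : ℤ => μ) n
  have hindep : iIndepFun (fun (i : ℕ) (x : ℤ → ℝ) => g (x (-i))) (iidLaw μ) :=
    (iIndepFun_infinitePi (P := fun _ : ℤ => μ) (X := fun _ => g) fun _ => hg).precomp
      (g := fun i : ℕ => -(i : ℤ)) (fun a b h => by simpa using h)
  have hid : ∀ i : ℕ, IdentDistrib (fun x : ℤ → ℝ => x (-i)) id (iidLaw μ) μ := fun i =>
    ⟨(measurable_pi_apply _).aemeasurable, measurable_id.aemeasurable, by
      rw [Measure.map_id]; exact (heval _).map_eq⟩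
  have hlaw := strong_law_ae_real (μ := iidLaw μ) (fun (i : ℕ) (x : ℤ → ℝ) => g (x (-i)))
    ((heval _).integrable_comp_of_integrable hint) (fun a b hab => hindep.indepFun hab)
    (fun i => ((hid i).trans (hid 0).symm).comp hg)
  have hmean : ∫ x : ℤ → ℝ, g (x (-(0 : ℕ))) ∂iidLaw μ = ∫ x, g x ∂μ :=
    ((hid 0).comp hg).integral_eq
  have hle' : ∀ᵐ x ∂iidLaw μ, ∀ i : ℕ, x (-i) - j / 2 ≤ g (x (-i)) :=
    ae_all_iff.2 fun i => (heval _).quasiMeasurePreserving.ae hle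
  filter_upwards [hlaw, hle'] with x hx hxle
  rw [hmean] at hx
  have h1 := (hx.neg_mul_atTop hneg tendsto_natCast_atTop_atTop).const_mul_atBot
    (two_pos : (0 : ℝ) < 2)
  refine tendsto_atBot_mono' _ ?_ h1
  filter_upwards [eventually_gt_atTop 0] with N hN
  have : (N : ℝ) ≠ 0 := by positivity
  rw [div_mul_cancel₀ _ this, Finset.mul_sum]
  exact Finset.sum_le_sum fun i _ => by linarith [hxle i]

theorem hasForgetfulCarrier_udK_coe_top {ν : Measure ℝ}
    (hmap : (μ.prod ν).map (udK j ⊤) = μ.prod ν) (hC : ∀ᵐ x ∂μ, x ≤ C) {g : ℝ → ℝ}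
    (hg : Measurable g) (hint : Integrable g μ) (hneg : ∫ x, g x ∂μ < 0)
    (hle : ∀ᵐ x ∂μ, x - j / 2 ≤ g x) : HasForgetfulCarrier (udK j ⊤) μ ν := by
  have hC' : ∀ᵐ x ∂iidLaw μ, ∀ n, x n ≤ C := ae_all_iff.2 fun n =>
    (measurePreserving_eval_infinitePi (fun _ : ℤ => μ) n).quasiMeasurePreserving.ae hC
  refine ⟨measurable_udK _ _, involutive_udK _ _, hmap, ?_, ?_⟩
  · filter_upwards [hC', ae_tendsto_backwardSum hg hint hneg hle] with x h1 h2
    obtain ⟨p, hp⟩ := exists_forall_backwardSum_le h1 h2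
    exact ⟨_, isSync_udK_coe_top h2 hp⟩
  · filter_upwards [hC', ae_tendsto_backwardSum hg hint hneg hle] with x h1 h2 u v hu hv
    obtain ⟨p, hp⟩ := exists_forall_backwardSum_le h1 h2
    rw [carrier_eq_of_isCarrier_of_isCarrier h1 h2 hp hu hv]
    exact isSync_udK_coe_top h2 hp

/-- A measure that is an exponential tilt of its reflection at `j / 2` has mean below `j / 2`. -/
theorem integral_lt_zero_of_map_reflect {lam R : ℝ} (hlam : 0 < lam)
    (hR : ∀ᵐ x ∂μ, |2 * x - j| ≤ R) (hne : μ ≠ Measure.dirac (j / 2))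
    (hrefl : μ.map (fun x => j - x) =
      μ.withDensity fun x => ENNReal.ofReal (Real.exp (lam * (2 * x - j)))) :
    Integrable (fun x => x - j / 2) μ ∧ ∫ x, (x - j / 2) ∂μ < 0 := by
  have hint : Integrable (fun x => 2 * x - j) μ :=
    Integrable.of_bound (by fun_prop) R hR
  have hint2 : Integrable (fun x => Real.exp (lam * (2 * x - j)) * (2 * x - j)) μ := by
    refine Integrable.of_bound (by fun_prop) (Real.exp (lam * R) * R) ?_
    filter_upwards [hR] with x hx
    rw [norm_mul, Real.norm_eq_abs, Real.norm_eq_abs, Real.abs_exp]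
    exact mul_le_mul (Real.exp_le_exp.2 (mul_le_mul_of_nonneg_left (le_of_abs_le hx) hlam.le)) hx
      (abs_nonneg _) (Real.exp_pos _).le
  have h1 : ∫ x, (2 * x - j) ∂(μ.map fun x => j - x) = -∫ x, (2 * x - j) ∂μ := by
    rw [integral_map (by fun_prop) (by fun_prop), ← integral_neg]
    congr 1
    funext x
    ring
  rw [hrefl, integral_withDensity_eq_integral_toReal_smul (by fun_prop)
    (.of_forall fun _ => ENNReal.ofReal_lt_top)] at h1
  simp only [ENNReal.toReal_ofReal (Real.exp_pos _).le, smul_eq_mul] at h1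
  -- With `y = 2 * x - j`, `h1` says that the mean of `y * exp (lam * y)` is minus the mean of `y`.
  -- As `y * exp (lam * y) ≥ y` with equality only at `y = 0`, the mean of `y` is at most `0`, and
  -- equals `0` only for the excluded point mass.
  have hpos : ∀ x : ℝ, 0 ≤ Real.exp (lam * (2 * x - j)) * (2 * x - j) - (2 * x - j) := by
    intro x
    rcases le_total 0 (2 * x - j) with h | h
    · have := Real.one_le_exp (mul_nonneg hlam.le h)
      nlinarith
    · have := Real.exp_le_one_iff.2 (mul_nonpos_of_nonneg_of_nonpos hlam.le h)
      nlinarith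
  have h2 := integral_sub hint2 hint
  rw [h1] at h2
  have hle : 0 ≤ ∫ x, (Real.exp (lam * (2 * x - j)) * (2 * x - j) - (2 * x - j)) ∂μ :=
    integral_nonneg hpos
  have hlt : ∫ x, (2 * x - j) ∂μ < 0 := by
    refine lt_of_le_of_ne (by linarith) fun h0 => hne (eq_dirac_of_ae_eq ?_)
    rw [h0, neg_zero, sub_zero] at h2
    filter_upwards [(integral_eq_zero_iff_of_nonneg_ae (.of_forall hpos)
      (hint2.sub hint)).1 h2] with x hx
    by_contra hxc
    have hx0 : 2 * x - j ≠ 0 := fun h => hxc (by linarith)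
    have h3 : (Real.exp (lam * (2 * x - j)) - 1) * (2 * x - j) = 0 := by
      rw [sub_mul, one_mul]; exact hx
    rcases mul_eq_zero.1 h3 with h4 | h4
    · have := Real.exp_eq_one_iff _ |>.1 (sub_eq_zero.1 h4)
      rcases mul_eq_zero.1 this with h5 | h5
      · exact hlam.ne' h5
      · exact hx0 h5
    · exact hx0 h4
  have h3 : (fun x : ℝ => x - j / 2) = fun x => (1 / 2) * (2 * x - j) := by
    funext x; ring
  rw [h3]
  refine ⟨hint.const_mul _, ?_⟩
  rw [integral_const_mul]
  linarith

/-- Truncation at `-1` gives integrability and keeps the function nonpositive, with zeros only at `j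
/ 2`. -/
theorem integral_max_lt_zero (hle : ∀ᵐ x ∂μ, x ≤ j / 2) (hne : μ ≠ Measure.dirac (j / 2)) :
    Integrable (fun x => max (x - j / 2) (-1)) μ ∧ ∫ x, max (x - j / 2) (-1) ∂μ < 0 := by
  have hnonpos : ∀ᵐ x ∂μ, max (x - j / 2) (-1) ≤ 0 := by
    filter_upwards [hle] with x hx using max_le (by linarith) (by norm_num)
  have hint : Integrable (fun x => max (x - j / 2) (-1)) μ := by
    refine Integrable.of_bound (by fun_prop) 1 ?_
    filter_upwards [hnonpos] with x hx
    rw [Real.norm_eq_abs, abs_le]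
    exact ⟨le_max_right _ _, hx.trans zero_le_one⟩
  refine ⟨hint, lt_of_le_of_ne (integral_nonpos_of_ae hnonpos) fun h0 =>
    hne (eq_dirac_of_ae_eq ?_)⟩
  have h1 : ∫ x, -max (x - j / 2) (-1) ∂μ = 0 := by rw [integral_neg, h0, neg_zero]
  filter_upwards [(integral_eq_zero_iff_of_nonneg_ae (by
    filter_upwards [hnonpos] with x hx using neg_nonneg.2 hx) hint.neg).1 h1] with x hx
  have h2 : max (x - j / 2) (-1) = 0 := neg_eq_zero.1 hx
  rcases max_cases (x - j / 2) (-1) with h | h <;> linarith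

end Drift

/-! ### Detailed balance -/

/-! ### Exchange maps on groups and densities -/

section Density

theorem map_withDensity_of_involutive {α : Type*} [MeasurableSpace α] {Q : Measure α} {f : α → α}
    (hf : MeasurePreserving f Q Q) (hinv : Function.Involutive f) {w : α → ENNReal}
    (hw : Measurable w) : (Q.withDensity w).map f = Q.withDensity (w ∘ f) := by
  ext s hs
  rw [Measure.map_apply hf.measurable hs, withDensity_apply _ (hf.measurable hs),
    withDensity_apply _ hs, ← hf.setLIntegral_comp_preimage hs (hw.comp hf.measurable)]
  simp only [Function.comp_apply, hinv _]

theorem withDensity_map_eq {α β : Type*} [MeasurableSpace α] [MeasurableSpace β] {Q : Measure α}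
    {f : α → β} (hf : Measurable f) {w : β → ENNReal} (hw : Measurable w) :
    (Q.map f).withDensity w = (Q.withDensity (w ∘ f)).map f := by
  ext s hs
  rw [withDensity_apply _ hs, Measure.map_apply hf hs, withDensity_apply _ (hf hs),
    setLIntegral_map hs hw hf]
  rfl

theorem indicator_mul_indicator_congr {α β : Type*} {A : Set α} {B : Set β} {f : α → ENNReal}
    {g : β → ENNReal} {x x' : α} {u u' : β} (hiff : x ∈ A ∧ u ∈ B ↔ x' ∈ A ∧ u' ∈ B)
    (hfg : x ∈ A → u ∈ B → f x * g u = f x' * g u') :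
    A.indicator f x * B.indicator g u = A.indicator f x' * B.indicator g u' := by
  by_cases h : x ∈ A ∧ u ∈ B
  · have h' := hiff.1 h
    rw [indicator_of_mem h.1, indicator_of_mem h.2, indicator_of_mem h'.1, indicator_of_mem h'.2,
      hfg h.1 h.2]
  · have h0 {y : α} {v : β} (h : ¬(y ∈ A ∧ v ∈ B)) : A.indicator f y * B.indicator g v = 0 := by
      rcases not_and_or.1 h with h | h
      · rw [indicator_of_notMem h, zero_mul]
      · rw [indicator_of_notMem h, mul_zero]
    rw [h0 h, h0 fun h' => h (hiff.2 h')]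

variable {G : Type*} [AddCommGroup G] [MeasurableSpace G] [MeasurableAdd₂ G] [MeasurableNeg G]
  [MeasurableSub₂ G] {Q : Measure G} [SFinite Q] [Q.IsAddLeftInvariant] [Q.IsNegInvariant]

/-- The map that exchanges two coordinates up to a function of their sum. -/
def exchange (φ : G → G) (p : G × G) : G × G := (p.2 - φ (p.1 + p.2), p.1 + φ (p.1 + p.2))

omit [MeasurableSpace G] [MeasurableAdd₂ G] [MeasurableNeg G] [MeasurableSub₂ G] in
theorem involutive_exchange (φ : G → G) : Function.Involutive (exchange φ) := by
  intro p
  have h : p.2 - φ (p.1 + p.2) + (p.1 + φ (p.1 + p.2)) = p.1 + p.2 := by abel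
  simp only [exchange, h]
  refine Prod.ext ?_ ?_ <;> simp

/-- In the coordinates sum `s` and second entry `u`, the map fixes `s` and reflects `u` to `s + φ s
- u`, which preserves an invariant measure. Stated for groups, it serves both Lebesgue measure on
`ℝ` and counting measure on `ℤ`. -/
theorem measurePreserving_exchange {φ : G → G} (hφ : Measurable φ) :
    MeasurePreserving (exchange φ) (Q.prod Q) (Q.prod Q) := by
  have : Q.IsAddRightInvariant := ⟨fun g => by
    simpa only [add_comm] using map_add_left_eq_self Q g⟩
  have h1 := measurePreserving_add_prod Q Q
  have h2 : MeasurePreserving (fun p : G × G => (p.1, p.1 + φ p.1 - p.2)) (Q.prod Q) (Q.prod Q) :=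
    (MeasurePreserving.id Q).skew_product (g := fun s u => s + φ s - u)
      ((measurable_fst.add (hφ.comp measurable_fst)).sub measurable_snd)
      (.of_forall fun s => Measure.map_sub_left_eq_self Q _)
  have h3 := measurePreserving_sub_prod Q Q
  convert h3.comp (h2.comp h1) using 1
  funext p
  refine Prod.ext ?_ ?_ <;> simp only [exchange, Function.comp_apply] <;> abel

theorem map_exchange_withDensity {φ : G → G} (hφ : Measurable φ) {f g : G → ENNReal}
    (hf : Measurable f) (hg : Measurable g)
    (hfg : ∀ x u, f (u - φ (x + u)) * g (x + φ (x + u)) = f x * g u) :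
    ((Q.withDensity f).prod (Q.withDensity g)).map (exchange φ) =
      (Q.withDensity f).prod (Q.withDensity g) := by
  rw [prod_withDensity hf hg, map_withDensity_of_involutive (measurePreserving_exchange hφ)
    (involutive_exchange φ) (w := fun p => f p.1 * g p.2)
      ((hf.comp measurable_fst).mul (hg.comp measurable_snd))]
  congr 1
  funext p
  exact hfg p.1 p.2

end Density

/-! ### The exchanged amount and the supports, over `ℝ` and `ℤ` alike -/

section Excess

variable {R : Type*} [CommRing R] [LinearOrder R] [IsStrictOrderedRing R]

/-- `max {s - J, 0}` in an ordered ring. -/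
def ringExcess : WithTop R → R → R
  | ⊤, _ => 0
  | (j : R), s => max (s - j) 0

omit [IsStrictOrderedRing R] in
theorem ringExcess_top (s : R) : ringExcess ⊤ s = 0 := rfl

omit [IsStrictOrderedRing R] in
theorem ringExcess_coe (j s : R) : ringExcess (j : WithTop R) s = max (s - j) 0 := rfl

/-- The amount exchanged by the map `udK J K`. -/
def ringFlow (J K : WithTop R) (s : R) : R := ringExcess J s - ringExcess K s

/-- The support `[c, K - c]` of the truncated distributions. -/
def truncSet (c : R) (K : WithTop R) : Set R := {x | c ≤ x ∧ (x : WithTop R) ≤ K.map fun k => k - c}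

omit [IsStrictOrderedRing R] in
theorem mem_truncSet_coe {c k x : R} : x ∈ truncSet c (k : WithTop R) ↔ c ≤ x ∧ x ≤ k - c := by
  rw [truncSet, mem_ofPred_eq, WithTop.map_coe, WithTop.coe_le_coe]

omit [IsStrictOrderedRing R] in
theorem mem_truncSet_top {c x : R} : x ∈ truncSet c (⊤ : WithTop R) ↔ c ≤ x := by
  simp [truncSet]

theorem exchange_mem_truncSet {c j x u : R} {K : WithTop R} (hjK : (j : WithTop R) ≤ K)
    (hx : x ∈ truncSet c (j : WithTop R)) (hu : u ∈ truncSet c K) :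
    u - ringFlow j K (x + u) ∈ truncSet c (j : WithTop R) ∧
      x + ringFlow j K (x + u) ∈ truncSet c K := by
  rw [mem_truncSet_coe] at hx ⊢
  rw [ringFlow, ringExcess_coe]
  induction K using WithTop.recTopCoe with
  | top =>
    rw [mem_truncSet_top] at hu ⊢
    rw [ringExcess_top]
    rcases max_cases (x + u - j) 0 with h | h <;> refine ⟨⟨?_, ?_⟩, ?_⟩ <;> linarith
  | coe k =>
    rw [mem_truncSet_coe] at hu ⊢
    rw [ringExcess_coe]
    have : j ≤ k := by exact_mod_cast hjK
    rcases max_cases (x + u - j) 0 with h | h <;> rcases max_cases (x + u - k) 0 with h' | h' <;>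
      refine ⟨⟨?_, ?_⟩, ?_, ?_⟩ <;> linarith

theorem exchange_mem_truncSet_iff {c j x u : R} {K : WithTop R} (hjK : (j : WithTop R) ≤ K) :
    u - ringFlow j K (x + u) ∈ truncSet c (j : WithTop R) ∧
      x + ringFlow j K (x + u) ∈ truncSet c K ↔ x ∈ truncSet c (j : WithTop R) ∧ u ∈ truncSet c K := by
  refine ⟨fun h => ?_, fun h => exchange_mem_truncSet hjK h.1 h.2⟩
  have h1 := exchange_mem_truncSet hjK h.1 h.2
  have h2 := involutive_exchange (ringFlow (j : WithTop R) K) (x, u)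
  simp only [exchange, Prod.mk.injEq] at h2
  rwa [h2.1, h2.2] at h1

end Excess

theorem excess_eq_ringExcess (J : WithTop ℝ) : excess J = ringExcess J := by
  funext s
  induction J using WithTop.recTopCoe <;> rfl

theorem udK_eq_exchange (J K : WithTop ℝ) : udK J K = exchange (ringFlow J K) := by
  funext p
  rw [udK, exchange, ringFlow, excess_eq_ringExcess, excess_eq_ringExcess]
  refine Prod.ext ?_ ?_ <;> simp only <;> ring

theorem measurable_ringFlow (J K : WithTop ℝ) : Measurable (ringFlow J K) := by
  unfold ringFlow
  rw [← excess_eq_ringExcess, ← excess_eq_ringExcess]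
  fun_prop

theorem prod_normalizedMeasure_map {m₁ m₂ : Measure ℝ} [SFinite m₁] [SFinite m₂]
    {F : ℝ × ℝ → ℝ × ℝ} (h : (m₁.prod m₂).map F = m₁.prod m₂) :
    ((normalizedMeasure m₁).prod (normalizedMeasure m₂)).map F =
      (normalizedMeasure m₁).prod (normalizedMeasure m₂) := by
  rw [normalizedMeasure, normalizedMeasure, Measure.prod_smul_left, Measure.prod_smul_right,
    Measure.map_smul, Measure.map_smul, h]

/-! #### Exponential marginals -/

theorem measurableSet_truncSet (c : ℝ) (K : WithTop ℝ) : MeasurableSet (truncSet c K) := by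
  induction K using WithTop.recTopCoe with
  | top =>
    have : truncSet c (⊤ : WithTop ℝ) = Ici c := by ext; exact mem_truncSet_top
    rw [this]; exact measurableSet_Ici
  | coe k =>
    have : truncSet c (k : WithTop ℝ) = Icc c (k - c) := by ext; exact mem_truncSet_coe
    rw [this]; exact measurableSet_Icc

theorem stExp_eq (lam c : ℝ) (K : WithTop ℝ) :
    stExp lam c (K.map fun k => k - c) = normalizedMeasure (volume.withDensity
      ((truncSet c K).indicator fun x => ENNReal.ofReal (Real.exp (-lam * x)))) := by
  rw [withDensity_indicator (measurableSet_truncSet c K)]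
  rfl

/-- On the supports, which the map respects, the joint density depends only on the conserved sum `x
+ u`. -/
theorem map_udK_stExp (lam c : ℝ) {j : ℝ} {K : WithTop ℝ} (hjK : (j : WithTop ℝ) ≤ K) :
    ((stExp lam c ((j : WithTop ℝ).map fun k => k - c)).prod
      (stExp lam c (K.map fun k => k - c))).map (udK j K) =
    (stExp lam c ((j : WithTop ℝ).map fun k => k - c)).prod
      (stExp lam c (K.map fun k => k - c)) := by
  have hm (K : WithTop ℝ) : Measurable
      ((truncSet c K).indicator fun x => ENNReal.ofReal (Real.exp (-lam * x))) :=
    Measurable.indicator (by fun_prop) (measurableSet_truncSet c K)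
  rw [stExp_eq, stExp_eq, udK_eq_exchange]
  refine prod_normalizedMeasure_map (map_exchange_withDensity (measurable_ringFlow _ _) (hm _)
    (hm _) fun x u => indicator_mul_indicator_congr (exchange_mem_truncSet_iff hjK) fun _ _ => ?_)
  rw [← ENNReal.ofReal_mul (Real.exp_pos _).le, ← ENNReal.ofReal_mul (Real.exp_pos _).le,
    ← Real.exp_add, ← Real.exp_add]
  congr 2
  ring

/-- The interval `[c, j - c]` is symmetric about `j / 2`, so reflection only changes the exponential
factor. This supplies the tilt needed for negative drift. -/
theorem map_reflect_stExp (lam c j : ℝ) :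
    (stExp lam c ((j : WithTop ℝ).map fun k => k - c)).map (fun x => j - x) =
      (stExp lam c ((j : WithTop ℝ).map fun k => k - c)).withDensity
        fun x => ENNReal.ofReal (Real.exp (lam * (2 * x - j))) := by
  have hm : Measurable ((truncSet c (j : WithTop ℝ)).indicator
      fun x => ENNReal.ofReal (Real.exp (-lam * x))) :=
    Measurable.indicator (by fun_prop) (measurableSet_truncSet c _)
  rw [stExp_eq, normalizedMeasure, Measure.map_smul, withDensity_smul_measure,
    map_withDensity_of_involutive ⟨by fun_prop, Measure.map_sub_left_eq_self _ j⟩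
      (fun x => sub_sub_cancel j x) hm, ← withDensity_mul _ hm (by fun_prop)]
  congr 2
  funext x
  have hiff : j - x ∈ truncSet c (j : WithTop ℝ) ↔ x ∈ truncSet c (j : WithTop ℝ) := by
    rw [mem_truncSet_coe, mem_truncSet_coe]
    constructor <;> rintro ⟨h1, h2⟩ <;> constructor <;> linarith
  rw [Pi.mul_apply, Function.comp_apply]
  by_cases h : x ∈ truncSet c (j : WithTop ℝ)
  · rw [indicator_of_mem (hiff.2 h), indicator_of_mem h, ← ENNReal.ofReal_mul (Real.exp_pos _).le,
      ← Real.exp_add]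
    congr 2
    ring
  · rw [indicator_of_notMem (fun h' => h (hiff.1 h')), indicator_of_notMem h, zero_mul]

theorem ae_stExp_mem_Icc (lam c j : ℝ) :
    ∀ᵐ x ∂stExp lam c ((j : WithTop ℝ).map fun k => k - c), x ∈ Icc c (j - c) := by
  refine Measure.ae_smul_measure ?_ _
  refine (withDensity_absolutelyContinuous _ _).ae_le ?_
  filter_upwards [ae_restrict_mem (measurableSet_truncSet c j)] with x hx
  exact mem_truncSet_coe.1 hx

/-! #### Geometric marginals -/

open Classical in
/-- The weights of the bipartite geometric distribution. -/
noncomputable def geoWeight (θ κ : ℝ) (x : ℤ) : ENNReal := ENNReal.ofReal (θ ^ x * if Even x then 1 else κ)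

/-- The embedding of the lattice `m ℤ`. -/
noncomputable def scaledCast (m : ℝ) (x : ℤ) : ℝ := m * x

theorem measurable_scaledCast (m : ℝ) : Measurable (scaledCast m) := measurable_of_countable _

theorem sstbGeo_eq (θ κ m : ℝ) (M : ℤ) (K : WithTop ℤ) :
    sstbGeo θ M (K.map fun a : ℤ => a - M) κ m = normalizedMeasure
      ((Measure.count.withDensity ((truncSet M K).indicator (geoWeight θ κ))).map
        (scaledCast m)) := by
  rw [sstbGeo, Measure.count, withDensity_sum, Measure.map_sum (measurable_scaledCast m).aemeasurable]
  congr 2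
  funext x
  rw [dirac_withDensity, Measure.map_smul, Measure.map_dirac' (measurable_scaledCast m)]
  simp only [indicator_apply, truncSet, mem_ofPred_eq, geoWeight]
  congr

theorem scaledCast_ringExcess {m : ℝ} (hm : 0 < m) (J : WithTop ℤ) (s : ℤ) :
    ringExcess (J.map (scaledCast m)) (scaledCast m s) = scaledCast m (ringExcess J s) := by
  induction J using WithTop.recTopCoe with
  | top => simp [ringExcess_top, scaledCast]
  | coe j =>
    rw [WithTop.map_coe, ringExcess_coe, ringExcess_coe]
    simp only [scaledCast]
    push_cast
    rw [mul_max_of_nonneg _ _ hm.le, mul_sub, mul_zero]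

theorem exchange_scaledCast {m : ℝ} (hm : 0 < m) (J K : WithTop ℤ) (p : ℤ × ℤ) :
    exchange (ringFlow (J.map (scaledCast m)) (K.map (scaledCast m)))
      (Prod.map (scaledCast m) (scaledCast m) p) =
    Prod.map (scaledCast m) (scaledCast m) (exchange (ringFlow J K) p) := by
  have hadd (a b : ℤ) : scaledCast m (a + b) = scaledCast m a + scaledCast m b := by
    simp only [scaledCast]; push_cast; ring
  have hsub (a b : ℤ) : scaledCast m (a - b) = scaledCast m a - scaledCast m b := by
    simp only [scaledCast]; push_cast; ring
  simp only [exchange, ringFlow, Prod.map, ← hadd, scaledCast_ringExcess hm, ← hsub]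

/-- The powers of `θ` depend on the sum alone. The powers of `κ` count odd entries; as the sums have
equal parity, matching `x` with one new entry matches the remaining two. -/
theorem geoWeight_mul {θ κ : ℝ} (hθ : 0 < θ) (hκ : 0 < κ) {x u x' u' : ℤ} (hs : x + u = x' + u')
    (hpar : κ ≠ 1 → (Even x ↔ Even x') ∨ (Even x ↔ Even u')) :
    geoWeight θ κ x * geoWeight θ κ u = geoWeight θ κ x' * geoWeight θ κ u' := by
  have hpos (a : ℤ) : 0 ≤ θ ^ a * if Even a then 1 else κ := by
    split_ifs <;> positivity
  simp only [geoWeight]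
  rw [← ENNReal.ofReal_mul (hpos _), ← ENNReal.ofReal_mul (hpos _), mul_mul_mul_comm,
    mul_mul_mul_comm (θ ^ x'), ← zpow_add₀ hθ.ne', ← zpow_add₀ hθ.ne', hs]
  congr 2
  by_cases h1 : κ = 1
  · simp [h1]
  · have h2 : Even (x + u) ↔ Even (x' + u') := by rw [hs]
    rw [Int.even_add, Int.even_add] at h2
    have h3 := hpar h1
    by_cases a : Even x <;> by_cases b : Even u <;> by_cases c : Even x' <;> by_cases d : Even u' <;>
      simp_all [-Int.not_even_iff_odd]

theorem map_udK_sstbGeo {θ κ m : ℝ} {M j : ℤ} {K : WithTop ℤ} (hm : 0 < m) (hθ : 0 < θ)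
    (hκ : 0 < κ) (hjK : (j : WithTop ℤ) ≤ K) (hj : κ ≠ 1 → Even (j - 2 * M))
    (hK : κ ≠ 1 → ∀ a : ℤ, K = (a : WithTop ℤ) → Even (a - 2 * M)) :
    ((sstbGeo θ M ((j : WithTop ℤ).map fun a : ℤ => a - M) κ m).prod
      (sstbGeo θ M (K.map fun a : ℤ => a - M) κ m)).map
        (udK ((j : WithTop ℤ).map (scaledCast m)) (K.map (scaledCast m))) =
    (sstbGeo θ M ((j : WithTop ℤ).map fun a : ℤ => a - M) κ m).prod
      (sstbGeo θ M (K.map fun a : ℤ => a - M) κ m) := by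
  rw [sstbGeo_eq, sstbGeo_eq]
  refine prod_normalizedMeasure_map ?_
  have hc := measurable_scaledCast m
  have hmeas := measurable_udK ((j : WithTop ℤ).map (scaledCast m)) (K.map (scaledCast m))
  rw [Measure.map_prod_map _ _ hc hc, Measure.map_map hmeas (hc.prodMap hc)]
  have hcomp : udK ((j : WithTop ℤ).map (scaledCast m)) (K.map (scaledCast m)) ∘
      Prod.map (scaledCast m) (scaledCast m) =
      Prod.map (scaledCast m) (scaledCast m) ∘ exchange (ringFlow (j : WithTop ℤ) K) := by
    funext p
    rw [udK_eq_exchange]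
    exact exchange_scaledCast hm _ _ p
  rw [hcomp, ← Measure.map_map (hc.prodMap hc) (measurable_of_countable _),
    map_exchange_withDensity (measurable_of_countable _) (measurable_of_countable _)
      (measurable_of_countable _)]
  intro x u
  refine indicator_mul_indicator_congr (exchange_mem_truncSet_iff hjK) fun _ _ => ?_
  refine geoWeight_mul hθ hκ (by ring) fun h1 => ?_
  -- The new first entry is `u`, `j - x` or `u - (k - j)`, the last only for finite `K`. With `j`
  -- and `k` even, it has the parity of `u` or of `x`.
  have hje := hj h1
  rw [ringFlow, ringExcess_coe]
  induction K using WithTop.recTopCoe with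
  | top =>
    rw [ringExcess_top]
    grind
  | coe k =>
    have hke := hK h1 k rfl
    have : j ≤ k := by exact_mod_cast hjK
    rw [ringExcess_coe]
    grind

/-- The rate `-log θ / m` makes the exponential equal `θ ^ (j - 2 * x)` at the lattice point `m *
x`. When `κ ≠ 1`, `j` is even, so `x` and `j - x` carry the same power of `κ`. -/
theorem map_reflect_sstbGeo {θ κ m : ℝ} {M j : ℤ} (hm : 0 < m) (hθ : 0 < θ) (hκ : 0 < κ)
    (hj : κ ≠ 1 → Even (j - 2 * M)) :
    (sstbGeo θ M ((j : WithTop ℤ).map fun a : ℤ => a - M) κ m).map (fun x => scaledCast m j - x) =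
      (sstbGeo θ M ((j : WithTop ℤ).map fun a : ℤ => a - M) κ m).withDensity
        fun x => ENNReal.ofReal (Real.exp (-Real.log θ / m * (2 * x - scaledCast m j))) := by
  have hc := measurable_scaledCast m
  have hcomp : (fun x => scaledCast m j - x) ∘ scaledCast m =
      scaledCast m ∘ fun x : ℤ => j - x := by
    funext x
    simp only [Function.comp_apply, scaledCast]
    push_cast; ring
  rw [sstbGeo_eq, normalizedMeasure, Measure.map_smul, withDensity_smul_measure,
    Measure.map_map (by fun_prop) hc, hcomp, ← Measure.map_map hc (measurable_of_countable _),
    map_withDensity_of_involutive ⟨measurable_of_countable _, Measure.map_sub_left_eq_self _ j⟩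
      (fun x => sub_sub_cancel j x) (measurable_of_countable _), withDensity_map_eq hc (by fun_prop),
    ← withDensity_mul _ (measurable_of_countable _) (measurable_of_countable _)]
  congr 3
  funext x
  have hiff : j - x ∈ truncSet M (j : WithTop ℤ) ↔ x ∈ truncSet M (j : WithTop ℤ) := by
    rw [mem_truncSet_coe, mem_truncSet_coe]
    constructor <;> rintro ⟨h1, h2⟩ <;> constructor <;> linarith
  rw [Pi.mul_apply, Function.comp_apply, Function.comp_apply]
  by_cases h : x ∈ truncSet M (j : WithTop ℤ)
  · rw [indicator_of_mem (hiff.2 h), indicator_of_mem h, geoWeight, geoWeight,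
      ← ENNReal.ofReal_mul (by split_ifs <;> positivity)]
    congr 1
    have h1 : Real.exp (-Real.log θ / m * (2 * scaledCast m x - scaledCast m j)) =
        θ ^ (j - 2 * x) := by
      rw [← Real.rpow_intCast, Real.rpow_def_of_pos hθ, scaledCast, scaledCast]
      congr 1
      push_cast
      field_simp
      ring
    rw [h1, mul_right_comm, ← zpow_add₀ hθ.ne', show x + (j - 2 * x) = j - x by ring]
    congr 1
    by_cases hk : κ = 1
    · simp [hk]
    · have : Even (j - x) ↔ Even x := by
        have := hj hk
        grind
      simp only [this]
  · rw [indicator_of_notMem (fun h' => h (hiff.1 h')), indicator_of_notMem h, zero_mul]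

theorem ae_sstbGeo_mem_Icc {θ κ m : ℝ} (hm : 0 < m) (M j : ℤ) :
    ∀ᵐ x ∂sstbGeo θ M ((j : WithTop ℤ).map fun a : ℤ => a - M) κ m,
      x ∈ Icc (scaledCast m M) (scaledCast m j - scaledCast m M) := by
  rw [sstbGeo_eq]
  refine Measure.ae_smul_measure ?_ _
  rw [ae_map_iff (p := fun x => x ∈ Icc (scaledCast m M) (scaledCast m j - scaledCast m M))
    (measurable_scaledCast m).aemeasurable measurableSet_Icc,
    withDensity_indicator (MeasurableSet.of_discrete)]
  refine (withDensity_absolutelyContinuous _ _).ae_le ?_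
  filter_upwards [ae_restrict_mem (MeasurableSet.of_discrete)] with x hx
  have h := mem_truncSet_coe.1 hx
  have h1 : (M : ℝ) ≤ x := by exact_mod_cast h.1
  have h2 : (x : ℝ) ≤ j - M := by exact_mod_cast h.2
  exact ⟨mul_le_mul_of_nonneg_left h1 hm.le, by
    rw [scaledCast, scaledCast, scaledCast, ← mul_sub]
    exact mul_le_mul_of_nonneg_left h2 hm.le⟩

/-! #### The remaining solutions -/

theorem map_eq_of_ae_eq_swap {μ : Measure ℝ} [SFinite μ] {F : ℝ × ℝ → ℝ × ℝ}
    (h : ∀ᵐ p ∂μ.prod μ, F p = p.swap) : (μ.prod μ).map F = μ.prod μ := by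
  rw [Measure.map_congr h, Measure.prod_swap]

/-- The sum never exceeds `j`, so the map acts as the swap. -/
theorem map_udK_low {μ : Measure ℝ} [SFinite μ] {j : ℝ} {K : WithTop ℝ}
    (hjK : (j : WithTop ℝ) ≤ K) (hμ : ∀ᵐ x ∂μ, x ≤ j / 2) :
    (μ.prod μ).map (udK j K) = μ.prod μ := by
  refine map_eq_of_ae_eq_swap ?_
  filter_upwards [Measure.quasiMeasurePreserving_fst.ae hμ,
    Measure.quasiMeasurePreserving_snd.ae hμ] with p h1 h2
  have h : p.1 + p.2 ≤ j := by linarith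
  rw [udK, excess_eq_zero (K := (j : WithTop ℝ)) (by exact_mod_cast h),
    excess_eq_zero (K := K) (le_trans (by exact_mod_cast h) hjK)]
  simp [Prod.swap]

/-- The sum is always at least `k`, so the constant amount `k - j` is exchanged and the map is the
swap up to the translation. -/
theorem map_udK_high {μ : Measure ℝ} [SFinite μ] {j k : ℝ} (hjk : j ≤ k)
    (hμ : ∀ᵐ x ∂μ, j / 2 ≤ x) :
    (μ.prod (μ.map fun x => x + (k - j))).map (udK j k) =
      μ.prod (μ.map fun x => x + (k - j)) := by
  have h1 : μ.prod (μ.map fun x => x + (k - j)) =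
      (μ.prod μ).map (Prod.map id fun x => x + (k - j)) := by
    rw [← Measure.map_prod_map _ _ measurable_id (by fun_prop), Measure.map_id]
  have h2 : udK j k ∘ Prod.map id (fun x => x + (k - j)) =ᵐ[μ.prod μ]
      Prod.map id (fun x => x + (k - j)) ∘ Prod.swap := by
    filter_upwards [Measure.quasiMeasurePreserving_fst.ae hμ,
      Measure.quasiMeasurePreserving_snd.ae hμ] with p h3 h4
    simp only [Function.comp_apply, Prod.map, udK, excess_coe, id, Prod.swap]
    rw [max_eq_left (by linarith), max_eq_left (by linarith)]
    refine Prod.ext ?_ ?_ <;> simp only <;> ring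
  rw [h1, Measure.map_map (measurable_udK _ _) (by fun_prop), Measure.map_congr h2,
    ← Measure.map_map (by fun_prop) measurable_swap, Measure.prod_swap]

/-! ### Forgetful carriers for the listed solutions, and conclusion -/

namespace IsUdKSolution

variable {J K : WithTop ℝ} {μ ν : Measure ℝ}

/-- For `J = K` the map is the swap, so equality of the marginals is all that detailed balance
requires there. -/
theorem eq_of_eq (h : IsUdKSolution J K μ ν) (hJK : J = K) : μ = ν := by
  cases h with
  | exponential lam c hlam hJ hK => rw [hJK]
  | geometric m θ κ M J' K' hm hθ hκ hJm hKm =>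
    have hinj : Function.Injective fun a : ℤ => m * (a : ℝ) := fun a b hab => by
      simpa [hm.ne'] using hab
    have : J' = K' := WithTop.map_injective hinj (by rw [← hJm, ← hKm, hJK])
    rw [this]
  | diagonal => rfl
  | low => rfl
  | point j hj h => exact absurd hJK h.ne
  | high j k hj hk h =>
    rw [hj, hk] at hJK
    exact absurd (WithTop.coe_injective hJK) h.ne

/-- Detailed balance. -/
theorem map_udK {j : ℝ} (h : IsUdKSolution j K μ ν) (hjK : (j : WithTop ℝ) < K)
    (hμ : μ ≠ Measure.dirac (j / 2)) : (μ.prod ν).map (udK j K) = μ.prod ν := by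
  cases h with
  | exponential lam c => exact map_udK_stExp lam c hjK.le
  | geometric m θ κ M J' K' hm hθ hκ hJm hKm hJ hK _ hJe hKe =>
    induction J' using WithTop.recTopCoe with
    | top => exact absurd hJm (by simp)
    | coe j' =>
      have hle : (j' : WithTop ℤ) ≤ K' := by
        induction K' using WithTop.recTopCoe with
        | top => exact le_top
        | coe k' =>
          rw [hJm, hKm, WithTop.map_coe, WithTop.map_coe, WithTop.coe_lt_coe,
            mul_lt_mul_iff_right₀ hm, Int.cast_lt] at hjK
          exact WithTop.coe_le_coe.2 hjK.le
      have h1 := map_udK_sstbGeo (θ := θ) (κ := κ) hm hθ hκ hle (fun hk => hJe hk j' rfl) hKe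
      rw [hJm, hKm]
      exact h1
  | diagonal _ _ hJK => exact absurd hJK hjK.ne
  | low j' hj _ _ hm hs =>
    obtain rfl := WithTop.coe_injective hj
    exact map_udK_low hjK.le hs
  | point j' hj =>
    obtain rfl := WithTop.coe_injective hj
    exact absurd rfl hμ
  | high j' k hj hk h _ hm hs =>
    obtain rfl := WithTop.coe_injective hj
    subst hk
    exact map_udK_high h.le hs

/-- For `K = ∞`, the mean of `μ` is below `J / 2`, possibly after truncation. -/
theorem exists_integral_lt_zero {j : ℝ} (h : IsUdKSolution j ⊤ μ ν)
    (hμ : μ ≠ Measure.dirac (j / 2)) :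
    ∃ C, (∀ᵐ x ∂μ, x ≤ C) ∧ ∃ g : ℝ → ℝ, Measurable g ∧ Integrable g μ ∧ ∫ x, g x ∂μ < 0 ∧
      ∀ᵐ x ∂μ, x - j / 2 ≤ g x := by
  have hprob := h.isProb.1
  have main {lam c : ℝ} (hlam : 0 < lam) (hI : ∀ᵐ x ∂μ, x ∈ Icc c (j - c))
      (hrefl : μ.map (fun x => j - x) =
        μ.withDensity fun x => ENNReal.ofReal (Real.exp (lam * (2 * x - j)))) :
      ∃ C, (∀ᵐ x ∂μ, x ≤ C) ∧ ∃ g : ℝ → ℝ, Measurable g ∧ Integrable g μ ∧ ∫ x, g x ∂μ < 0 ∧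
        ∀ᵐ x ∂μ, x - j / 2 ≤ g x := by
    refine ⟨j - c, hI.mono fun x hx => hx.2, fun x => x - j / 2, by fun_prop, ?_⟩
    have hR : ∀ᵐ x ∂μ, |2 * x - j| ≤ j - 2 * c := by
      filter_upwards [hI] with x hx
      rw [abs_le]
      constructor <;> linarith [hx.1, hx.2]
    obtain ⟨h1, h2⟩ := integral_lt_zero_of_map_reflect hlam hR hμ hrefl
    exact ⟨h1, h2, .of_forall fun _ => le_rfl⟩
  cases h with
  | exponential lam c hlam =>
    exact main (hlam (.inr rfl)) (ae_stExp_mem_Icc lam c j) (map_reflect_stExp lam c j)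
  | geometric m θ κ M J' K' hm hθ hκ hJm hKm hJ hK hθ1 hJe =>
    induction J' using WithTop.recTopCoe with
    | top => exact absurd hJm (by simp)
    | coe j' =>
      have hj : j = scaledCast m j' := WithTop.coe_injective hJm
      have hl : 0 < -Real.log θ / m := div_pos (neg_pos.2 (Real.log_neg hθ (hθ1 (.inr rfl)))) hm
      rw [hj] at main ⊢
      exact main hl (ae_sstbGeo_mem_Icc hm M j')
        (map_reflect_sstbGeo hm hθ hκ fun hk => hJe hk j' rfl)
  | diagonal _ _ hJK => exact absurd hJK (by simp)
  | low j' hj _ _ hm hs =>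
    obtain rfl := WithTop.coe_injective hj
    obtain ⟨h1, h2⟩ := integral_max_lt_zero hs hμ
    exact ⟨j / 2, hs, _, by fun_prop, h1, h2, .of_forall fun _ => le_max_left _ _⟩
  | point j' hj =>
    obtain rfl := WithTop.coe_injective hj
    exact absurd rfl hμ
  | high j' k hj hk => exact absurd hk (by simp)

theorem hasForgetfulCarrier {j : ℝ} (h : IsUdKSolution j K μ ν) (hjK : (j : WithTop ℝ) < K)
    (hμ : μ ≠ Measure.dirac (j / 2)) : HasForgetfulCarrier (udK j K) μ ν := by
  have hprob := h.isProb.1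
  have hmap := h.map_udK hjK hμ
  induction K using WithTop.recTopCoe with
  | top =>
    obtain ⟨C, hC, g, hg, hint, hneg, hle⟩ := h.exists_integral_lt_zero hμ
    exact hasForgetfulCarrier_udK_coe_top hmap hC hg hint hneg hle
  | coe k =>
    obtain ⟨B, L, hBm, hpos, hB⟩ := isResetBlock_udK_coe_of_ne_dirac (WithTop.coe_lt_coe.1 hjK) hμ
    exact hB.hasForgetfulCarrier hBm hpos (measurable_udK _ _) (involutive_udK _ _) hmap

end IsUdKSolution

theorem map_udK_swap {J K : WithTop ℝ} {μ ν : Measure ℝ} [SFinite μ] [SFinite ν]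
    (h : (μ.prod ν).map (udK J K) = μ.prod ν) : (ν.prod μ).map (udK K J) = ν.prod μ := by
  have h1 : udK K J = Prod.swap ∘ udK J K ∘ Prod.swap := by
    rw [← swapMap_udK]; rfl
  rw [h1, ← Measure.map_map measurable_swap ((measurable_udK J K).comp measurable_swap),
    ← Measure.map_map (measurable_udK J K) measurable_swap, Measure.prod_swap, h,
    Measure.prod_swap]

/-- One of the two half-lines of `outerSet` has positive mass, and each is a reset set of length
two; for `K = ∞` only the lower one is present. -/
theorem exists_isResetBlock_of_outerSet {j : ℝ} {K : WithTop ℝ} (hjK : (j : WithTop ℝ) ≤ K)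
    {ν : Measure ℝ} (hν : 0 < ν (outerSet j K)) :
    ∃ B L, MeasurableSet B ∧ 0 < ν B ∧ IsResetBlock (udK K j) B L := by
  by_cases h1 : ν (Iic (j / 2)) = 0
  · have h2 : ν {y | ∃ i k : ℝ, (j : WithTop ℝ) = i ∧ K = k ∧ k - i / 2 ≤ y} ≠ 0 := by
      intro h2
      refine hν.ne' (measure_union_null (measure_mono_null (fun y hy => ?_) h1) h2)
      have : 2 * y ≤ j := WithTop.coe_le_coe.1 hy
      exact mem_Iic.2 (by linarith)
    induction K using WithTop.recTopCoe with
    | top => simp at h2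
    | coe k =>
      refine ⟨Ici (k - j / 2), 2, measurableSet_Ici, ?_,
        isResetBlock_udK_swap_ge (WithTop.coe_le_coe.1 hjK)⟩
      refine lt_of_lt_of_le (pos_iff_ne_zero.2 h2) (measure_mono ?_)
      rintro y ⟨i, k', hi, hk, hy⟩
      rwa [WithTop.coe_injective hi, WithTop.coe_injective hk, mem_Ici]
  · exact ⟨_, 2, measurableSet_Iic, pos_iff_ne_zero.2 h1, isResetBlock_udK_swap_le hjK⟩

theorem theorem3p7 (J K : WithTop ℝ) (hJK : J ≤ K)
    (μ ν : Measure ℝ)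
    (hsol : IsUdKSolution J K μ ν)
    (hμ : ∀ j : ℝ, J = (j : WithTop ℝ) → μ ≠ Measure.dirac (j / 2))
    (hν : 0 < ν (outerSet J K)) :
    ((∀ᵐ x ∂(iidLaw μ), x ∈ uniqueIVP (udK J K)) ∧
      IsErgodicUnder (latticeStep (udK J K)) (iidLaw μ)) ∧
    ((∀ᵐ x ∂(iidLaw ν), x ∈ uniqueIVP (udK K J) ∩ uniqueCarrier (udK K J)) ∧
      IsErgodicUnder (latticeStep (udK K J)) (iidLaw ν)) := by
  have hp1 := hsol.isProb.1
  have hp2 := hsol.isProb.2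
  obtain ⟨h, B, L, hBm, hpos, hB⟩ : HasForgetfulCarrier (udK J K) μ ν ∧
      ∃ B L, MeasurableSet B ∧ 0 < ν B ∧ IsResetBlock (udK K J) B L := by
    rcases hJK.eq_or_lt with heq | hlt
    · obtain rfl := hsol.eq_of_eq heq
      subst heq
      exact ⟨(isResetBlock_udK_self J).hasForgetfulCarrier MeasurableSet.univ (by simp)
        (measurable_udK _ _) (involutive_udK _ _)
        (map_eq_of_ae_eq_swap (.of_forall (udK_self J))),
        univ, 1, MeasurableSet.univ, by simp, isResetBlock_udK_self J⟩
    · obtain ⟨j, rfl⟩ := WithTop.ne_top_iff_exists.1 hlt.ne_top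
      exact ⟨hsol.hasForgetfulCarrier hlt (hμ j rfl), exists_isResetBlock_of_outerSet hlt.le hν⟩
  -- `udK J K` and `udK K J` are swaps of each other, so each provides the space-time transpose in
  -- the ergodicity proof of the other.
  have h' : HasForgetfulCarrier (udK K J) ν μ := hB.hasForgetfulCarrier hBm hpos
    (measurable_udK _ _) (involutive_udK _ _) (map_udK_swap h.map_prod)
  exact ⟨⟨h.ae_mem_uniqueIVP, h.isErgodicUnder_latticeStep (by rwa [swapMap_udK])⟩,
    h'.ae_mem_uniqueIVP.and (hB.ae_mem_uniqueCarrier hBm hpos h'),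
    h'.isErgodicUnder_latticeStep (by rwa [swapMap_udK])⟩
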